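/- Let $l>-1/2$, let $q:(0,\infty)\to\mathbb R$ be locally integrable, and assume $x\,q(x)\in L^p(0,1)$ for some $p\in I_l$, where $I_l=[1,\infty]$ if $l>0$ and $I_l=[1,\tfrac{-1}{2l})$ if $-\tfrac12<l\le 0$ (read as $[1,\infty)$ for $l=0$). Here $W^{1,p}(0,1)$ is the space of absolutely continuous functions on $(0,1)$ (extended continuously to $[0,1]$) whose derivative lies in $L^p(0,1)$, $(x)_k=x(x+1)\cdots(x+k-1)$, and a solution of the differential equation is a differentiable function $u$ with $u'$ locally absolutely continuous on $(0,\infty)$ satisfying the equation almost everywhere. For every $z\in\mathbb C$ the equation $$-u''+\Big(\frac{l(l+1)}{x^2}+q(x)\Big)u=zu\quad\text{on }(0,\infty)$$ has exactly one solution $u=\phi(z,\cdot)$ with $\lim_{x\to0+}x^{-(l+1)}\phi(z,x)=1$; for each $x>0$ the function $z\mapsto\phi(z,x)$ is entire. For every $z_0\in\mathbb C$ there are functions $\widetilde\phi_k(z_0,\cdot)$, $\widehat\phi_k(z_0,\cdot)$, $k\in\mathbb N_0$, such that for all $z\in\mathbb C$ and $x>0$ (with convergent series, and $'=\partial/\partial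 x$) $$\phi(z,x)=x^{l+1}\sum_{k=0}^\infty\frac{x^{2k}\,\widetilde\phi_k(z_0,x)}{k!}(z-z_0)^k,\qquad \phi'(z,x)=x^{l}\sum_{k=0}^\infty\frac{x^{2k}\,\widehat\phi_k(z_0,x)}{k!}(z-z_0)^k,$$ and for every $k\in\mathbb N_0$: $$\widetilde\phi_k(z_0,\cdot),\ \widehat\phi_k(z_0,\cdot)\in W^{1,p}(0,1),$$ $$\widetilde\phi_k(z_0,0)=C_{l,k}^\phi,\qquad \widehat\phi_k(z_0,0)=(l+1+2k)\,C_{l,k}^\phi,\qquad C_{l,k}^\phi=\frac{(-1)^k}{4^k(l+\frac32)_k},$$ and $\widetilde\phi_k(z_0,\cdot)$ is differentiable on $(0,\infty)$ with $\lim_{x\to0+}x\,\widetilde\phi_k'(z_0,x)=0$. -/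

import Mathlib

open Set Filter Topology MeasureTheory
open scoped ENNReal

namespace PerturbedBessel

/-- The admissible exponents: `[1, ∞]` if `0 < l`, and `[1, -1/(2l))` if `-1/2 < l ≤ 0`,
where `-1/(2l)` is read as `∞` for `l = 0`. -/
noncomputable def exponents (l : ℝ) : Set ℝ≥0∞ :=
  if 0 < l then Icc 1 ⊤ else Ico 1 (1 / ENNReal.ofReal (-2 * l))

/-- `f` belongs to `W^{1,p}(0,1)`: it is absolutely continuous (on `[0,1]`, so that `f 0` is the
boundary value of `f` at `0`) and its derivative lies in `L^p(0,1)`. -/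
def MemW1p (p : ℝ≥0∞) (f : ℝ → ℂ) : Prop :=
  AbsolutelyContinuousOnInterval f 0 1 ∧ MemLp (deriv f) p (volume.restrict (Ioo 0 1))

/-- `u` solves `-u'' + (l(l+1)/x² + q) u = z u` on `(0,∞)`: `u` is differentiable, `u'` is locally
absolutely continuous, and the equation holds almost everywhere. -/
def IsSolution (l : ℝ) (q : ℝ → ℝ) (z : ℂ) (u : ℝ → ℂ) : Prop :=
  (∀ x > 0, DifferentiableAt ℝ u x) ∧
  (∀ a b : ℝ, 0 < a → a ≤ b → AbsolutelyContinuousOnInterval (deriv u) a b) ∧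
  ∀ᵐ x ∂(volume.restrict (Ioi (0 : ℝ))), ∃ u'' : ℂ, HasDerivAt (deriv u) u'' x ∧
    -u'' + ((l * (l + 1) / x ^ 2 + q x : ℝ) : ℂ) * u x = z * u x

/-- A solution normalized at the singular endpoint by `u(x) = x^{l+1} (1 + o(1))` as `x → 0+`. -/
def IsNormalizedSolution (l : ℝ) (q : ℝ → ℝ) (z : ℂ) (u : ℝ → ℂ) : Prop :=
  IsSolution l q z u ∧ Tendsto (fun x : ℝ => u x / ((x ^ (l + 1) : ℝ) : ℂ)) (𝓝[>] 0) (𝓝 1)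

/-- `C_{l,k} = (-1)^k / (4^k (l+3/2)_k)`, with the rising factorial `(x)_k = x(x+1)⋯(x+k-1)`. -/
noncomputable def coeffC (l : ℝ) (k : ℕ) : ℝ :=
  (-1) ^ k / (4 ^ k * (ascPochhammer ℝ k).eval (l + 3 / 2))

end PerturbedBessel

namespace PerturbedBessel

/-! ### Complex-valued absolutely continuous functions -/

section AbsolutelyContinuous

/-! Put `a = 2l + 1 > 0` and `u = x^(l+1) v`. The differential equation turns into `(x^(a+1) v')' =
x^(a+1) (q - z) v`, and the normalization into `v(0) = 1`. Integrating twice from `0` gives the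
Volterra equation `v = 1 + volt a (x (q - z) v)`, with `v' = hardy a (x (q - z) v)`. The second
solution would contribute a multiple of `x^(-a)` to `v`, which the normalization excludes, so the
two problems are equivalent (`isNormalizedSolution_of_volterra`,
`IsNormalizedSolution.exists_volterra`).

Since `x q` is integrable near `0`, `f ↦ volt a (r f)` has norm at most `1/c` in the sup norm
weighted by `exp (c * majorant)` (`norm_volt_mul_le`). This gives existence by a Neumann series,
uniqueness by absorption, and, with `c` arbitrarily large, an infinite radius of convergence for the
expansion `v = ∑ (z - z₀)^k v_k`. Its coefficients satisfy `v_0 = 1 + volt a (s v_0)` and `v_{k+1} =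
volt a (s v_{k+1} - t v_k)` with `s = x (q - z₀)`.

Regularity concerns `w_k = v_k / x^(2k)` and `h_k = x v_k' / x^(2k)`; up to the factor `k!`, `φ̃_k`
is `w_k` and `φ̂_k` is `(l+1) w_k + h_k`. Hardy's inequality makes `x * hardy α f` a `W^{1,p}`
function vanishing at `0` whenever `f ∈ L^p` and `α > 0`, and integration by parts shows that `hardy
(α - 1)` preserves `W^{1,p}`, dividing the boundary value by `α`. Rescaling the recursion gives
`h_{k+1} = x hardy_{a+2k+2} (s w_{k+1}) - hardy_{a+2k+1} w_k` and `w_{k+1} = hardy_{2k+1} h_{k+1}`.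
Induction yields both the regularity and the boundary values, the two divisions producing `C_{k+1} =
-C_k / ((2k+2)(a+2k+2))`. The limit of `x φ̃_k'` vanishes because `h_k - 2k w_k` has boundary value
`0`. -/

theorem _root_.AbsolutelyContinuousOnInterval.comp_lipschitzOn {X Y : Type*} [PseudoMetricSpace X]
    [PseudoMetricSpace Y] {f : ℝ → X} {g : X → Y} {a b : ℝ} {K : NNReal} {s : Set X}
    (hf : AbsolutelyContinuousOnInterval f a b) (hg : LipschitzOnWith K g s)
    (hs : MapsTo f (uIcc a b) s) : AbsolutelyContinuousOnInterval (fun x => g (f x)) a b := by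
  rw [absolutelyContinuousOnInterval_iff] at hf ⊢
  intro ε hε
  obtain ⟨δ, hδ, H⟩ := hf (ε / (K + 1)) (by positivity)
  refine ⟨δ, hδ, fun E hE hE' => ?_⟩
  have h1 := H E hE hE'
  calc _ ≤ ∑ i ∈ Finset.range E.1, K * dist (f (E.2 i).1) (f (E.2 i).2) := by
        refine Finset.sum_le_sum fun i hi => ?_
        have := hE.1 i hi
        exact hg.dist_le_mul (f (E.2 i).1) (hs this.1) (f (E.2 i).2) (hs this.2)
    _ = K * ∑ i ∈ Finset.range E.1, dist (f (E.2 i).1) (f (E.2 i).2) := by rw [Finset.mul_sum]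
    _ ≤ (K + 1) * ∑ i ∈ Finset.range E.1, dist (f (E.2 i).1) (f (E.2 i).2) := by
        gcongr
        simp
    _ < (K + 1) * (ε / (K + 1)) := by gcongr
    _ = ε := by field_simp

theorem _root_.AbsolutelyContinuousOnInterval.ofReal_comp {f : ℝ → ℝ} {a b : ℝ}
    (hf : AbsolutelyContinuousOnInterval f a b) :
    AbsolutelyContinuousOnInterval (fun x => (f x : ℂ)) a b :=
  AbsolutelyContinuousOnInterval.comp_lipschitzOn (s := univ) hf
    (Complex.isometry_ofReal.lipschitz.lipschitzOnWith) (fun _ _ => mem_univ _)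

theorem _root_.AbsolutelyContinuousOnInterval.complex_mul {f g : ℝ → ℂ} {a b : ℝ}
    (hf : AbsolutelyContinuousOnInterval f a b) (hg : AbsolutelyContinuousOnInterval g a b) :
    AbsolutelyContinuousOnInterval (fun x => f x * g x) a b := by
  simpa using hf.fun_smul hg

theorem absolutelyContinuousOnInterval_const {X : Type*} [PseudoMetricSpace X] (c : X) (a b : ℝ) :
    AbsolutelyContinuousOnInterval (fun _ => c) a b :=
  ((LipschitzWith.const c).lipschitzOnWith (s := uIcc a b)).absolutelyContinuousOnInterval

theorem _root_.AbsolutelyContinuousOnInterval.congr_eqOn {X : Type*} [PseudoMetricSpace X]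
    {f g : ℝ → X} {a b : ℝ} (hf : AbsolutelyContinuousOnInterval f a b) (h : EqOn f g (uIcc a b)) :
    AbsolutelyContinuousOnInterval g a b := by
  rw [absolutelyContinuousOnInterval_iff] at hf ⊢
  intro ε hε
  obtain ⟨δ, hδ, H⟩ := hf ε hε
  refine ⟨δ, hδ, fun E hE hE' => ?_⟩
  convert H E hE hE' using 1
  refine Finset.sum_congr rfl fun i hi => ?_
  have := hE.1 i hi
  rw [h this.1, h this.2]

theorem absolutelyContinuousOnInterval_integral {f : ℝ → ℂ} {a b c : ℝ}
    (h : IntervalIntegrable f volume a b) (hc : c ∈ uIcc a b) :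
    AbsolutelyContinuousOnInterval (fun x => ∫ v in c..x, f v) a b := by
  have hre : IntervalIntegrable (fun x => (f x).re) volume a b := ⟨h.1.re, h.2.re⟩
  have him : IntervalIntegrable (fun x => (f x).im) volume a b := ⟨h.1.im, h.2.im⟩
  have h1 := (AbsolutelyContinuousOnInterval.ofReal_comp
    (hre.absolutelyContinuousOnInterval_intervalIntegral hc))
  have h2 := (AbsolutelyContinuousOnInterval.ofReal_comp
    (him.absolutelyContinuousOnInterval_intervalIntegral hc)).const_smul Complex.I
  refine AbsolutelyContinuousOnInterval.congr_eqOn (h1.fun_add h2) fun x hx => ?_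
  have hi : IntervalIntegrable f volume c x := h.mono_set (uIcc_subset_uIcc hc hx)
  have hr' : IntervalIntegrable (fun x => ((f x).re : ℂ)) volume c x :=
    ⟨hi.1.re.ofReal, hi.2.re.ofReal⟩
  have hi' : IntervalIntegrable (fun x => ((f x).im : ℂ)) volume c x :=
    ⟨hi.1.im.ofReal, hi.2.im.ofReal⟩
  rw [smul_eq_mul, ← intervalIntegral.integral_ofReal, ← intervalIntegral.integral_ofReal,
    ← intervalIntegral.integral_const_mul, ← intervalIntegral.integral_add hr' (hi'.const_mul _)]
  refine intervalIntegral.integral_congr fun y _ => ?_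
  rw [mul_comm, Complex.re_add_im]

/-- Subtracting the primitive of `g` leaves an absolutely continuous function with derivative zero
almost everywhere, hence a constant. -/
theorem integral_eq_sub_of_ae_hasDerivAt {f g : ℝ → ℂ} {a b : ℝ}
    (hf : AbsolutelyContinuousOnInterval f a b) (hg : IntervalIntegrable g volume a b)
    (h : ∀ᵐ x, x ∈ uIcc a b → HasDerivAt f (g x) x) : ∫ x in a..b, g x = f b - f a := by
  have h1 := hf.fun_sub (absolutelyContinuousOnInterval_integral hg left_mem_uIcc)
  have h2 : ∀ᵐ x, x ∈ uIcc a b → HasDerivAt (fun x => f x - ∫ v in a..x, g v) 0 x := by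
    filter_upwards [h, hg.ae_hasDerivAt_integral] with x hx hx' hm
    simpa using! (hx hm).sub (hx' hm a left_mem_uIcc)
  obtain ⟨C, hC⟩ := h1.const_of_ae_hasDerivAt_zero h2
  have ha := hC a left_mem_uIcc
  have hb := hC b right_mem_uIcc
  simp only [intervalIntegral.integral_same, sub_zero] at ha
  rw [ha, ← hb]; ring

theorem absolutelyContinuousOnInterval_rpow (s : ℝ) {a b : ℝ} (ha : 0 < a) (hb : 0 < b) :
    AbsolutelyContinuousOnInterval (fun x : ℝ => ((x ^ s : ℝ) : ℂ)) a b := by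
  refine AbsolutelyContinuousOnInterval.ofReal_comp (ContDiffOn.absolutelyContinuousOnInterval ?_)
  intro x hx
  have : 0 < x := lt_of_lt_of_le (lt_min ha hb) hx.1
  exact (Real.contDiffAt_rpow_const_of_ne this.ne').contDiffWithinAt

end AbsolutelyContinuous

/-- The weighted averaging operator `x^{-α-1} ∫_0^x y^α f(y) dy` of Hardy type. -/
noncomputable def hardy (α : ℝ) (f : ℝ → ℂ) (x : ℝ) : ℂ :=
  ((x ^ (-α - 1) : ℝ) : ℂ) * ∫ y in 0..x, ((y ^ α : ℝ) : ℂ) * f y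

/-! ### Hardy averaging: `L^p` bounds and integration by parts -/

section Hardy

variable {α : ℝ}

theorem intervalIntegrable_rpow_mul (hα : 0 ≤ α) {f : ℝ → ℂ} {a b : ℝ}
    (hf : IntervalIntegrable f volume a b) :
    IntervalIntegrable (fun y => ((y ^ α : ℝ) : ℂ) * f y) volume a b := by
  refine hf.continuousOn_mul (Continuous.continuousOn ?_)
  exact Complex.continuous_ofReal.comp (Real.continuous_rpow_const hα)

theorem hardy_continuousOn (hα : 0 ≤ α) {f : ℝ → ℂ} {b : ℝ} (hb : 0 ≤ b)
    (hf : IntervalIntegrable f volume 0 b) : ContinuousOn (hardy α f) (Ioc 0 b) := by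
  have h1 : ContinuousOn (fun x => ∫ y in 0..x, ((y ^ α : ℝ) : ℂ) * f y) (uIcc 0 b) :=
    (absolutelyContinuousOnInterval_integral (intervalIntegrable_rpow_mul hα hf)
      left_mem_uIcc).continuousOn
  rw [uIcc_of_le hb] at h1
  refine ContinuousOn.mul ?_ (h1.mono Ioc_subset_Icc_self)
  refine Complex.continuous_ofReal.comp_continuousOn fun x hx => ?_
  exact (Real.continuousAt_rpow_const x _ (Or.inl hx.1.ne')).continuousWithinAt

theorem lintegral_rpow_le (hα : 0 < α) {y b : ℝ} (hy : 0 < y) :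
    ∫⁻ x in Ioo y b, ENNReal.ofReal (x ^ (-α - 1)) ≤ ENNReal.ofReal (α⁻¹ * y ^ (-α)) := by
  calc _ ≤ ∫⁻ x in Ioi y, ENNReal.ofReal (x ^ (-α - 1)) := lintegral_mono_set Ioo_subset_Ioi_self
    _ = ENNReal.ofReal (∫ x in Ioi y, x ^ (-α - 1)) := by
        rw [ofReal_integral_eq_lintegral_ofReal (integrableOn_Ioi_rpow_of_lt (by linarith) hy)]
        filter_upwards [ae_restrict_mem measurableSet_Ioi] with x hx
        exact Real.rpow_nonneg (hy.trans hx).le _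
    _ = _ := by
        rw [integral_Ioi_rpow_of_lt (by linarith) hy]
        congr 1
        rw [show -α - 1 + 1 = -α by ring, neg_div_neg_eq, div_eq_inv_mul]

/-- Tonelli bound for the averaging operator on `L¹`. -/
theorem lintegral_hardy_le (hα : 0 < α) {b : ℝ} {g : ℝ → ℝ≥0∞}
    (hg : AEMeasurable g (volume.restrict (Ioo 0 b))) :
    ∫⁻ x in Ioo 0 b, ∫⁻ y in Ioo 0 x, ENNReal.ofReal (x ^ (-α - 1) * y ^ α) * g y ≤
      ENNReal.ofReal α⁻¹ * ∫⁻ y in Ioo 0 b, g y := by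
  set μ := volume.restrict (Ioo 0 b) with hμ
  let k : ℝ → ℝ → ℝ≥0∞ := fun x y =>
    {q : ℝ × ℝ | q.2 < q.1}.indicator
      (fun q => ENNReal.ofReal (q.1 ^ (-α - 1) * q.2 ^ α) * g q.2) (x, y)
  have hk : AEMeasurable (Function.uncurry k) (μ.prod μ) := by
    refine AEMeasurable.indicator (AEMeasurable.mul ?_ hg.comp_snd)
      (measurableSet_lt measurable_snd measurable_fst)
    refine Measurable.aemeasurable ?_
    fun_prop
  have h1 : ∫⁻ x in Ioo 0 b, ∫⁻ y in Ioo 0 x, ENNReal.ofReal (x ^ (-α - 1) * y ^ α) * g y =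
      ∫⁻ x, ∫⁻ y, k x y ∂μ ∂μ := by
    refine setLIntegral_congr_fun measurableSet_Ioo fun x hx => ?_
    have : k x = (Iio x).indicator (fun y => ENNReal.ofReal (x ^ (-α - 1) * y ^ α) * g y) := by
      ext y
      by_cases h : y < x <;> simp [k, h]
    simp only [this]
    rw [lintegral_indicator measurableSet_Iio, hμ, Measure.restrict_restrict measurableSet_Iio]
    congr 2
    ext y
    simp only [mem_Ioo, mem_inter_iff, mem_Iio]
    exact ⟨fun h => ⟨h.2, h.1, h.2.trans hx.2⟩, fun h => ⟨h.2.1, h.1⟩⟩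
  -- After the swap, the integral of `x^(-α-1)` over `(y, b)` is at most `y^(-α)/α`, which cancels
  -- the weight `y^α`.
  rw [h1, lintegral_lintegral_swap hk, ← lintegral_const_mul' _ _ ENNReal.ofReal_ne_top]
  refine setLIntegral_mono_ae' measurableSet_Ioo (ae_of_all _ fun y hy => ?_)
  have hk' : (fun x => k x y) =
      (Ioi y).indicator (fun x => ENNReal.ofReal (x ^ (-α - 1) * y ^ α) * g y) := by
    ext x
    by_cases h : y < x <;> simp [k, h]
  rw [hk', lintegral_indicator measurableSet_Ioi, hμ, Measure.restrict_restrict measurableSet_Ioi]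
  have hset : Ioi y ∩ Ioo 0 b = Ioo y b := by
    ext x
    simp only [mem_Ioo, mem_inter_iff, mem_Ioi]
    exact ⟨fun h => ⟨h.1, h.2.2⟩, fun h => ⟨h.1, hy.1.trans h.1, h.2⟩⟩
  rw [hset, lintegral_mul_const _ (by fun_prop)]
  gcongr
  have h2 : ∀ x, ENNReal.ofReal (x ^ (-α - 1) * y ^ α) =
      ENNReal.ofReal (x ^ (-α - 1)) * ENNReal.ofReal (y ^ α) := fun x =>
    ENNReal.ofReal_mul' (Real.rpow_nonneg hy.1.le _)
  simp_rw [h2]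
  rw [lintegral_mul_const _ (by fun_prop)]
  calc _ ≤ ENNReal.ofReal (α⁻¹ * y ^ (-α)) * ENNReal.ofReal (y ^ α) := by
        gcongr; exact lintegral_rpow_le hα hy.1
    _ = ENNReal.ofReal α⁻¹ := by
        rw [← ENNReal.ofReal_mul' (Real.rpow_nonneg hy.1.le _), mul_assoc, ← Real.rpow_add hy.1]
        simp

theorem enorm_hardy_le {f : ℝ → ℂ} {x : ℝ} (hx : 0 < x) :
    ‖hardy α f x‖ₑ ≤ ∫⁻ y in Ioo 0 x, ENNReal.ofReal (x ^ (-α - 1) * y ^ α) * ‖f y‖ₑ := by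
  have hx' := Real.rpow_nonneg hx.le (-α - 1)
  rw [hardy, intervalIntegral.integral_of_le hx.le, integral_Ioc_eq_integral_Ioo,
    ← integral_const_mul]
  refine (enorm_integral_le_lintegral_enorm _).trans (le_of_eq ?_)
  refine setLIntegral_congr_fun measurableSet_Ioo fun y hy => ?_
  rw [← mul_assoc, ← Complex.ofReal_mul, enorm_mul]
  congr 1
  rw [← ofReal_norm, Complex.norm_real, Real.norm_of_nonneg]
  exact mul_nonneg hx' (Real.rpow_nonneg hy.1.le _)

/-- Hardy's inequality: the averaging operator with `α > 0` is bounded on `L^p(0,b)`, `1 ≤ p`. -/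
theorem memLp_hardy (hα : 0 < α) {f : ℝ → ℂ} {b : ℝ} (hb : 0 ≤ b) {p : ℝ≥0∞} (hp : 1 ≤ p)
    (hf : MemLp f p (volume.restrict (Ioo 0 b))) :
    MemLp (hardy α f) p (volume.restrict (Ioo 0 b)) := by
  have hfin : IsFiniteMeasure (volume.restrict (Ioo (0:ℝ) b)) := inferInstance
  have hint : IntervalIntegrable f volume 0 b := by
    rw [intervalIntegrable_iff_integrableOn_Ioo_of_le hb]
    exact hf.integrable hp
  have hmeas : AEStronglyMeasurable (hardy α f) (volume.restrict (Ioo 0 b)) :=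
    ((hardy_continuousOn hα.le hb hint).mono Ioo_subset_Ioc_self).aestronglyMeasurable
      measurableSet_Ioo
  refine ⟨hmeas, ?_⟩
  -- On `(0, x)` the kernel is at most `1/x`, so `ν x` has mass at most one. Hence the average is
  -- bounded by the `L^1(ν x)` norm and so by the `L^p(ν x)` norm. For finite `p`, integrating the
  -- `p`-th power over `x` reduces the claim to the `L^1` bound applied to `‖f‖^p`.
  let w : ℝ → ℝ → ℝ≥0∞ := fun x y => ENNReal.ofReal (x ^ (-α - 1) * y ^ α)
  have hw : ∀ x, Measurable (w x) := fun x => by fun_prop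
  let ν : ℝ → Measure ℝ := fun x => (volume.restrict (Ioo 0 x)).withDensity (w x)
  have hsub : ∀ x ∈ Ioo 0 b, volume.restrict (Ioo 0 x) ≤ volume.restrict (Ioo 0 b) := fun x hx =>
    Measure.restrict_mono (Ioo_subset_Ioo_right hx.2.le) le_rfl
  have hν : ∀ x ∈ Ioo 0 b, ν x ≪ volume.restrict (Ioo 0 b) := fun x hx =>
    (withDensity_absolutelyContinuous _ _).trans (Measure.absolutelyContinuous_of_le (hsub x hx))
  have hmass : ∀ x ∈ Ioo 0 b, ν x univ ≤ 1 := by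
    intro x hx
    rw [withDensity_apply _ MeasurableSet.univ, Measure.restrict_univ]
    calc ∫⁻ y in Ioo 0 x, w x y ≤ ∫⁻ y in Ioo 0 x, ENNReal.ofReal x⁻¹ := by
          refine setLIntegral_mono measurable_const fun y hy => ENNReal.ofReal_le_ofReal ?_
          calc x ^ (-α - 1) * y ^ α ≤ x ^ (-α - 1) * x ^ α := by
                gcongr
                · exact Real.rpow_nonneg hx.1.le _
                · exact hy.1.le
                · exact hy.2.le
            _ = x⁻¹ := by
                rw [← Real.rpow_add hx.1, show -α - 1 + α = -1 by ring, Real.rpow_neg_one]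
      _ = 1 := by
          rw [setLIntegral_const, Real.volume_Ioo, sub_zero, ← ENNReal.ofReal_mul (by
            have := hx.1; positivity), inv_mul_cancel₀ hx.1.ne', ENNReal.ofReal_one]
  have key : ∀ x ∈ Ioo 0 b, ‖hardy α f x‖ₑ ≤ eLpNorm f p (ν x) := by
    intro x hx
    have hfm : AEStronglyMeasurable f (ν x) := hf.1.mono_ac (hν x hx)
    calc ‖hardy α f x‖ₑ ≤ ∫⁻ y in Ioo 0 x, w x y * ‖f y‖ₑ := enorm_hardy_le hx.1
      _ = eLpNorm f 1 (ν x) := by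
          rw [eLpNorm_one_eq_lintegral_enorm,
            lintegral_withDensity_eq_lintegral_mul₀' (hw x).aemeasurable hfm.enorm]
          rfl
      _ ≤ eLpNorm f p (ν x) * ν x univ ^ (1 / (1 : ℝ≥0∞).toReal - 1 / p.toReal) :=
          eLpNorm_le_eLpNorm_mul_rpow_measure_univ hp hfm
      _ ≤ eLpNorm f p (ν x) * 1 := by
          gcongr
          refine ENNReal.rpow_le_one (hmass x hx) ?_
          rcases eq_or_ne p ⊤ with h | h
          · simp [h]
          · have : 1 ≤ p.toReal := by
              rw [← ENNReal.toReal_one]; exact ENNReal.toReal_mono h hp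
            have h3 : 1 / p.toReal ≤ 1 := by rw [div_le_one (by linarith)]; exact this
            simpa using h3
      _ = _ := mul_one _
  rcases eq_or_ne p ⊤ with h | h
  · subst h
    refine lt_of_le_of_lt ?_ hf.2
    rw [eLpNorm_exponent_top, eLpNorm_exponent_top]
    refine essSup_le_of_ae_le _ ?_
    filter_upwards [ae_restrict_mem measurableSet_Ioo] with x hx
    refine (key x hx).trans ?_
    rw [eLpNorm_exponent_top]
    exact eLpNormEssSup_mono_measure f (hν x hx)
  · have hp0 : p ≠ 0 := (zero_lt_one.trans_le hp).ne'
    have hp1 : 0 < p.toReal := ENNReal.toReal_pos hp0 h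
    rw [eLpNorm_lt_top_iff_lintegral_rpow_enorm_lt_top hp0 h]
    have hff := (eLpNorm_lt_top_iff_lintegral_rpow_enorm_lt_top hp0 h).1 hf.2
    have hgm : AEMeasurable (fun y => ‖f y‖ₑ ^ p.toReal) (volume.restrict (Ioo 0 b)) :=
      hf.1.enorm.pow_const _
    refine lt_of_le_of_lt ?_
      (lt_of_le_of_lt (lintegral_hardy_le hα hgm) (ENNReal.mul_lt_top ENNReal.ofReal_lt_top hff))
    refine setLIntegral_mono_ae' measurableSet_Ioo (ae_of_all _ fun x hx => ?_)
    calc ‖hardy α f x‖ₑ ^ p.toReal ≤ eLpNorm f p (ν x) ^ p.toReal := by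
          gcongr; exact key x hx
      _ = ∫⁻ y, ‖f y‖ₑ ^ p.toReal ∂(ν x) := by
          rw [eLpNorm_eq_lintegral_rpow_enorm_toReal hp0 h, ← ENNReal.rpow_mul,
            one_div_mul_cancel hp1.ne', ENNReal.rpow_one]
      _ = _ := by
          rw [lintegral_withDensity_eq_lintegral_mul₀' (hw x).aemeasurable
            (hgm.mono_ac (hν x hx))]
          rfl

theorem intervalIntegrable_hardy (hα : 0 < α) {f : ℝ → ℂ} {b : ℝ} (hb : 0 ≤ b)
    (hf : IntervalIntegrable f volume 0 b) : IntervalIntegrable (hardy α f) volume 0 b := by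
  rw [intervalIntegrable_iff_integrableOn_Ioo_of_le hb, IntegrableOn, ← memLp_one_iff_integrable]
    at hf ⊢
  exact memLp_hardy hα hb le_rfl hf

theorem mul_hardy {f : ℝ → ℂ} {x : ℝ} (hx : 0 < x) :
    (x : ℂ) * hardy α f x = ((x ^ (-α) : ℝ) : ℂ) * ∫ y in 0..x, ((y ^ α : ℝ) : ℂ) * f y := by
  rw [hardy, ← mul_assoc, ← Complex.ofReal_mul, Real.rpow_sub hx, Real.rpow_one,
    mul_div_cancel₀ _ hx.ne']

/-- The product is `∫_0^x (y/x)^α f(y) dy`, whose weight is at most one. -/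
theorem norm_mul_hardy_le (hα : 0 ≤ α) {f : ℝ → ℂ} {x : ℝ} (hx : 0 ≤ x)
    (hf : IntervalIntegrable f volume 0 x) :
    ‖(x : ℂ) * hardy α f x‖ ≤ ∫ y in 0..x, ‖f y‖ := by
  rcases hx.eq_or_lt with rfl | hx
  · simp
  rw [mul_hardy hx, ← intervalIntegral.integral_const_mul]
  refine (intervalIntegral.norm_integral_le_integral_norm hx.le).trans ?_
  refine intervalIntegral.integral_mono_on hx.le
    ((intervalIntegrable_rpow_mul hα hf).const_mul _).norm hf.norm fun y hy => ?_
  rw [← mul_assoc, norm_mul, ← Complex.ofReal_mul, Complex.norm_real, Real.norm_of_nonneg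
    (mul_nonneg (Real.rpow_nonneg hx.le _) (Real.rpow_nonneg hy.1 _))]
  refine mul_le_of_le_one_left (norm_nonneg _) ?_
  calc x ^ (-α) * y ^ α ≤ x ^ (-α) * x ^ α := by
        gcongr
        · exact hy.1
        · exact hy.2
    _ = 1 := by rw [← Real.rpow_add hx]; simp

theorem tendsto_mul_hardy (hα : 0 ≤ α) {f : ℝ → ℂ} {b : ℝ} (hb : 0 < b)
    (hf : IntervalIntegrable f volume 0 b) :
    Tendsto (fun x : ℝ => (x : ℂ) * hardy α f x) (𝓝[>] 0) (𝓝 0) := by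
  have h1 : ContinuousOn (fun x => ∫ y in 0..x, ‖f y‖) (uIcc 0 b) :=
    intervalIntegral.continuousOn_primitive_interval' hf.norm left_mem_uIcc
  have h2 : Tendsto (fun x => ∫ y in 0..x, ‖f y‖) (𝓝[>] 0) (𝓝 0) := by
    have := h1 0 left_mem_uIcc
    rw [ContinuousWithinAt, intervalIntegral.integral_same] at this
    refine this.mono_left ?_
    rw [uIcc_of_le hb.le]
    rw [← nhdsWithin_Ioc_eq_nhdsGT hb]
    exact nhdsWithin_mono _ Ioc_subset_Icc_self
  refine squeeze_zero_norm' ?_ h2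
  filter_upwards [Ioc_mem_nhdsGT hb] with x hx
  exact norm_mul_hardy_le hα hx.1.le (hf.mono_set (by
    rw [uIcc_of_le hx.1.le, uIcc_of_le hb.le]; exact Icc_subset_Icc_right hx.2))

theorem ae_hasDerivAt_mul_hardy (hα : 0 ≤ α) {f : ℝ → ℂ} {b : ℝ} (hb : 0 ≤ b)
    (hf : IntervalIntegrable f volume 0 b) :
    ∀ᵐ x, x ∈ Ioo 0 b → HasDerivAt (fun x : ℝ => (x : ℂ) * hardy α f x)
      (f x - α * hardy α f x) x := by
  filter_upwards [(intervalIntegrable_rpow_mul hα hf).ae_hasDerivAt_integral] with x hx hm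
  have h1 := hx (by rw [uIcc_of_le hb]; exact Ioo_subset_Icc_self hm) 0 left_mem_uIcc
  have h2 : HasDerivAt (fun x : ℝ => ((x ^ (-α) : ℝ) : ℂ)) ((-α * x ^ (-α - 1) : ℝ) : ℂ) x :=
    (Real.hasDerivAt_rpow_const (Or.inl hm.1.ne')).ofReal_comp
  have h3 := h2.mul h1
  have h4 := h3.congr_of_eventuallyEq (f₁ := fun x : ℝ => (x : ℂ) * hardy α f x) (by
    filter_upwards [Ioi_mem_nhds hm.1] with y hy
    exact mul_hardy hy)
  convert! h4 using 1
  rw [hardy]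
  have : ((x ^ (-α) : ℝ) : ℂ) * ((x ^ α : ℝ) : ℂ) = 1 := by
    rw [← Complex.ofReal_mul, ← Real.rpow_add hm.1]; simp
  rw [← mul_assoc ((x ^ (-α) : ℝ) : ℂ), this]
  push_cast
  ring

theorem absolutelyContinuousOnInterval_mul_hardy (hα : 0 ≤ α) {f : ℝ → ℂ} {a b : ℝ} (ha : 0 < a)
    (hab : a ≤ b) (hf : IntervalIntegrable f volume 0 b) :
    AbsolutelyContinuousOnInterval (fun x : ℝ => (x : ℂ) * hardy α f x) a b := by
  have h1 : AbsolutelyContinuousOnInterval (fun x => ∫ y in 0..x, ((y ^ α : ℝ) : ℂ) * f y) a b :=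
    (absolutelyContinuousOnInterval_integral (intervalIntegrable_rpow_mul hα hf)
      left_mem_uIcc).mono (by
        rw [uIcc_of_le hab, uIcc_of_le (ha.le.trans hab)]; exact Icc_subset_Icc_left ha.le)
  refine ((absolutelyContinuousOnInterval_rpow (-α) ha
    (ha.trans_le hab)).complex_mul h1).congr_eqOn fun x hx => ?_
  rw [uIcc_of_le hab] at hx
  exact (mul_hardy (ha.trans_le hx.1)).symm

/-- `x · hardy α f` is a primitive of `f - α · hardy α f`. -/
theorem integral_sub_hardy (hα : 0 < α) {f : ℝ → ℂ} {x : ℝ} (hx : 0 ≤ x)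
    (hf : IntervalIntegrable f volume 0 x) :
    ∫ t in 0..x, (f t - α * hardy α f t) = (x : ℂ) * hardy α f x := by
  rcases hx.eq_or_lt with rfl | hx
  · simp
  have hg : IntervalIntegrable (fun t => f t - α * hardy α f t) volume 0 x :=
    hf.sub ((intervalIntegrable_hardy hα hx.le hf).const_mul _)
  -- The factor `x^(-α)` is singular at `0`, so the fundamental theorem is applied on `[ε, x]` and
  -- then `ε → 0`.
  have h1 : ∀ ε ∈ Ioc 0 x, (∫ t in 0..ε, (f t - α * hardy α f t)) - ε * hardy α f ε =
      (∫ t in 0..x, (f t - α * hardy α f t)) - x * hardy α f x := by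
    intro ε hε
    have hε1 : IntervalIntegrable (fun t => f t - α * hardy α f t) volume ε x :=
      hg.mono_set (by
        rw [uIcc_of_le hε.2, uIcc_of_le hx.le]; exact Icc_subset_Icc_left hε.1.le)
    have hε0 : IntervalIntegrable (fun t => f t - α * hardy α f t) volume 0 ε :=
      hg.mono_set (by
        rw [uIcc_of_le hε.1.le, uIcc_of_le hx.le]; exact Icc_subset_Icc_right hε.2)
    have h2 := integral_eq_sub_of_ae_hasDerivAt
      (absolutelyContinuousOnInterval_mul_hardy hα.le hε.1 hε.2 hf) hε1 (by
        have hxx : ∀ᵐ y : ℝ, y ≠ x := by simp [ae_iff, measure_singleton]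
        filter_upwards [ae_hasDerivAt_mul_hardy hα.le hx.le hf, hxx] with y hy hyx hm
        rw [uIcc_of_le hε.2] at hm
        exact hy ⟨hε.1.trans_le hm.1, lt_of_le_of_ne hm.2 hyx⟩)
    rw [← intervalIntegral.integral_add_adjacent_intervals hε0 hε1, h2]
    ring
  have h3 : Tendsto (fun ε : ℝ => (∫ t in 0..ε, (f t - α * hardy α f t)) - ε * hardy α f ε)
      (𝓝[>] 0) (𝓝 (0 - 0)) := by
    refine Tendsto.sub ?_ (tendsto_mul_hardy hα.le hx hf)
    have h4 := (absolutelyContinuousOnInterval_integral hg left_mem_uIcc).continuousOn 0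
      left_mem_uIcc
    rw [ContinuousWithinAt, intervalIntegral.integral_same] at h4
    refine h4.mono_left ?_
    rw [uIcc_of_le hx.le, ← nhdsWithin_Ioc_eq_nhdsGT hx]
    exact nhdsWithin_mono _ Ioc_subset_Icc_self
  have h5 := h3.congr' (f₂ := fun _ => (∫ t in 0..x, (f t - α * hardy α f t)) - x * hardy α f x)
    (by filter_upwards [Ioc_mem_nhdsGT hx] with ε hε using h1 ε hε)
  have h6 := tendsto_nhds_unique h5 tendsto_const_nhds
  rw [sub_zero] at h6
  exact sub_eq_zero.1 h6.symm

/-- Integration by parts: averaging a primitive. -/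
theorem hardy_sub_one_of_primitive (hα : 0 < α) {F g : ℝ → ℂ} {c : ℂ} {b : ℝ}
    (hg : IntervalIntegrable g volume 0 b) (hF : ∀ x ∈ Icc 0 b, F x = c + ∫ t in 0..x, g t)
    {x : ℝ} (hx : x ∈ Ioc 0 b) :
    α * hardy (α - 1) F x = F x - x * hardy α g x := by
  have hsub : uIcc 0 x ⊆ uIcc 0 b := by
    rw [uIcc_of_le hx.1.le, uIcc_of_le (hx.1.le.trans hx.2)]; exact Icc_subset_Icc_right hx.2
  have hg' : IntervalIntegrable g volume 0 x := hg.mono_set hsub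
  have hr : IntervalIntegrable (fun t : ℝ => α * t ^ (α - 1)) volume 0 x :=
    (intervalIntegral.intervalIntegrable_rpow' (by linarith)).const_mul _
  -- Writing `t^α` as a primitive of the integrable function `α t^(α-1)` gives absolute continuity
  -- up to `0`, also for `α < 1`.
  have hpow : ∀ t : ℝ, t ^ α = ∫ s in 0..t, α * s ^ (α - 1) := by
    intro t
    rw [intervalIntegral.integral_const_mul, integral_rpow (Or.inl (by linarith)), sub_add_cancel,
      Real.zero_rpow hα.ne', sub_zero, mul_div_cancel₀ _ hα.ne']
  have hFac : AbsolutelyContinuousOnInterval F 0 x := by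
    refine ((absolutelyContinuousOnInterval_const c 0 x).fun_add
      (absolutelyContinuousOnInterval_integral hg' left_mem_uIcc)).congr_eqOn fun t ht => ?_
    rw [uIcc_of_le hx.1.le] at ht
    exact (hF t ⟨ht.1, ht.2.trans hx.2⟩).symm
  have hPac : AbsolutelyContinuousOnInterval (fun t : ℝ => ((t ^ α : ℝ) : ℂ)) 0 x := by
    refine AbsolutelyContinuousOnInterval.ofReal_comp ?_
    refine (hr.absolutelyContinuousOnInterval_intervalIntegral left_mem_uIcc).congr_eqOn
      fun t _ => (hpow t).symm
  have i1 : IntervalIntegrable (fun t : ℝ => ((α * t ^ (α - 1) : ℝ) : ℂ) * F t) volume 0 x := by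
    refine IntervalIntegrable.mul_continuousOn ?_ hFac.continuousOn
    exact ⟨hr.1.ofReal, hr.2.ofReal⟩
  have i2 := intervalIntegrable_rpow_mul hα.le hg'
  have h1 := integral_eq_sub_of_ae_hasDerivAt (hPac.complex_mul hFac) (i1.add i2) (by
    have hxx : ∀ᵐ y : ℝ, y ≠ x := by simp [ae_iff, measure_singleton]
    have hx0 : ∀ᵐ y : ℝ, y ≠ 0 := by simp [ae_iff, measure_singleton]
    filter_upwards [hg'.ae_hasDerivAt_integral, hxx, hx0] with y hy hyx hy0 hm
    have hy1 := (hy hm 0 left_mem_uIcc).const_add c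
    rw [uIcc_of_le hx.1.le] at hm
    have hm' : y ∈ Ioo 0 x := ⟨lt_of_le_of_ne hm.1 (Ne.symm hy0), lt_of_le_of_ne hm.2 hyx⟩
    have hy2 : HasDerivAt F (g y) y := by
      refine hy1.congr_of_eventuallyEq ?_
      filter_upwards [Ioo_mem_nhds hm'.1 hm'.2] with t ht
      exact hF t ⟨ht.1.le, ht.2.le.trans hx.2⟩
    have hy3 : HasDerivAt (fun x : ℝ => ((x ^ α : ℝ) : ℂ)) ((α * y ^ (α - 1) : ℝ) : ℂ) y :=
      (Real.hasDerivAt_rpow_const (Or.inl hy0)).ofReal_comp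
    exact hy3.mul hy2)
  rw [intervalIntegral.integral_add i1 i2] at h1
  have h2 : ∫ t in 0..x, ((α * t ^ (α - 1) : ℝ) : ℂ) * F t =
      α * ∫ t in 0..x, ((t ^ (α - 1) : ℝ) : ℂ) * F t := by
    rw [← intervalIntegral.integral_const_mul]
    congr 1; ext t; push_cast; ring
  rw [h2, Real.zero_rpow hα.ne', Complex.ofReal_zero] at h1
  have h3 : ((x ^ (-α) : ℝ) : ℂ) * ((x ^ α : ℝ) : ℂ) = 1 := by
    rw [← Complex.ofReal_mul, ← Real.rpow_add hx.1]; simp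
  rw [mul_hardy hx.1, hardy, show -(α - 1) - 1 = -α by ring]
  linear_combination ((x ^ (-α) : ℝ) : ℂ) * h1 + F x * h3

end Hardy

/-- The iterated integral `∫_0^x t^{-a-1} ∫_0^t y^{a+1} q(y) v(y) dy dt` as an operator acting on
`f(y) = y q(y) v(y)`. -/
noncomputable def volt (a : ℝ) (f : ℝ → ℂ) (x : ℝ) : ℂ := ∫ t in 0..x, hardy a f t

/-! ### The Volterra operator -/

section Volterra

variable {a : ℝ}

/-- The identity `integral_sub_hardy` solved for the double integral. It leaves only single
integrals of `f`, from which bounds, linearity and interchange with series follow. -/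
theorem mul_volt (ha : 0 < a) {f : ℝ → ℂ} {x : ℝ} (hx : 0 ≤ x)
    (hf : IntervalIntegrable f volume 0 x) :
    a * volt a f x = (∫ t in 0..x, f t) - x * hardy a f x := by
  rw [← integral_sub_hardy ha hx hf, intervalIntegral.integral_sub hf
    ((intervalIntegrable_hardy ha hx hf).const_mul _), intervalIntegral.integral_const_mul, volt]
  ring

theorem norm_volt_le (ha : 0 < a) {f : ℝ → ℂ} {x : ℝ} (hx : 0 ≤ x)
    (hf : IntervalIntegrable f volume 0 x) :
    ‖volt a f x‖ ≤ 2 / a * ∫ t in 0..x, ‖f t‖ := by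
  have h1 : a * ‖volt a f x‖ ≤ 2 * ∫ t in 0..x, ‖f t‖ := by
    have : a * ‖volt a f x‖ = ‖a * volt a f x‖ := by
      rw [norm_mul, Complex.norm_real, Real.norm_of_nonneg ha.le]
    rw [this, mul_volt ha hx hf, two_mul]
    exact (norm_sub_le _ _).trans (add_le_add (intervalIntegral.norm_integral_le_integral_norm hx)
      (norm_mul_hardy_le ha.le hx hf))
  rw [div_mul_eq_mul_div, le_div_iff₀ ha]
  linarith

theorem volt_continuousOn (ha : 0 < a) {f : ℝ → ℂ}
    (hf : ∀ b, 0 ≤ b → IntervalIntegrable f volume 0 b) : ContinuousOn (volt a f) (Ici 0) := by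
  intro x hx
  have hx' : (0:ℝ) ≤ x + 1 := by have : (0:ℝ) ≤ x := hx; linarith
  have h1 : ContinuousOn (volt a f) (uIcc 0 (x + 1)) :=
    (absolutelyContinuousOnInterval_integral (intervalIntegrable_hardy ha hx' (hf _ hx'))
      left_mem_uIcc).continuousOn
  rw [uIcc_of_le hx'] at h1
  refine (h1 x ⟨hx, by linarith⟩).mono_of_mem_nhdsWithin ?_
  rw [← Ici_inter_Iic]
  exact inter_mem self_mem_nhdsWithin (mem_nhdsWithin_of_mem_nhds (Iic_mem_nhds (by linarith)))

theorem hasDerivAt_volt (ha : 0 < a) {f : ℝ → ℂ}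
    (hf : ∀ b, 0 ≤ b → IntervalIntegrable f volume 0 b) {x : ℝ} (hx : 0 < x) :
    HasDerivAt (volt a f) (hardy a f x) x := by
  have hx' : (0:ℝ) ≤ x + 1 := by linarith
  have hc := hardy_continuousOn ha.le hx' (hf _ hx')
  have hn : Ioc 0 (x + 1) ∈ 𝓝 x := Ioc_mem_nhds hx (by linarith)
  refine intervalIntegral.integral_hasDerivAt_right
    (intervalIntegrable_hardy ha hx.le (hf _ hx.le)) ?_ (hc.continuousAt hn)
  exact ⟨_, hn, hc.aestronglyMeasurable measurableSet_Ioc⟩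

theorem hardy_congr {α : ℝ} {f g : ℝ → ℂ} {x : ℝ} (hx : 0 ≤ x) (h : EqOn f g (Ioc 0 x)) :
    hardy α f x = hardy α g x := by
  rw [hardy, hardy, intervalIntegral.integral_of_le hx, intervalIntegral.integral_of_le hx]
  congr 1
  refine setIntegral_congr_fun measurableSet_Ioc fun y hy => ?_
  simp only [h hy]

theorem hardy_add {α : ℝ} (hα : 0 ≤ α) {f g : ℝ → ℂ} {x : ℝ}
    (hf : IntervalIntegrable f volume 0 x) (hg : IntervalIntegrable g volume 0 x) :
    hardy α (fun y => f y + g y) x = hardy α f x + hardy α g x := by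
  simp only [hardy, mul_add]
  rw [intervalIntegral.integral_add (intervalIntegrable_rpow_mul hα hf)
    (intervalIntegrable_rpow_mul hα hg), mul_add]

theorem hardy_const_mul {α : ℝ} (c : ℂ) (f : ℝ → ℂ) (x : ℝ) :
    hardy α (fun y => c * f y) x = c * hardy α f x := by
  have h : (fun y : ℝ => ((y ^ α : ℝ) : ℂ) * (c * f y)) =
      fun y : ℝ => c * (((y ^ α : ℝ) : ℂ) * f y) := by ext y; ring
  rw [hardy, hardy, h, intervalIntegral.integral_const_mul, mul_left_comm]

theorem volt_add (ha : 0 < a) {f g : ℝ → ℂ} {x : ℝ} (hx : 0 ≤ x)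
    (hf : IntervalIntegrable f volume 0 x) (hg : IntervalIntegrable g volume 0 x) :
    volt a (fun y => f y + g y) x = volt a f x + volt a g x := by
  have ha' : (a : ℂ) ≠ 0 := by exact_mod_cast ha.ne'
  apply mul_left_cancel₀ ha'
  rw [mul_volt ha hx (hf.add hg), mul_add, mul_volt ha hx hf, mul_volt ha hx hg,
    hardy_add ha.le hf hg, intervalIntegral.integral_add hf hg]
  ring

theorem volt_const_mul (c : ℂ) (f : ℝ → ℂ) (x : ℝ) :
    volt a (fun y => c * f y) x = c * volt a f x := by
  simp only [volt, hardy_const_mul]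
  exact intervalIntegral.integral_const_mul _ _

end Volterra

/-! ### Exponentially weighted estimates, Gronwall bound and uniqueness -/

section Majorant

variable {a : ℝ} {r : ℝ → ℂ}

/-- A function dominating the growth of the kernels of `volt a (r · )` and `volt a (id · )`. -/
noncomputable def majorant (a : ℝ) (r : ℝ → ℂ) (x : ℝ) : ℝ :=
  ∫ t in 0..x, 2 / a * (‖r t‖ + |t|)

theorem intervalIntegrable_density {x : ℝ} (hr : IntervalIntegrable r volume 0 x) :
    IntervalIntegrable (fun t => 2 / a * (‖r t‖ + |t|)) volume 0 x :=
  (hr.norm.add (continuous_abs.intervalIntegrable _ _)).const_mul _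

theorem absolutelyContinuousOnInterval_exp_majorant (c : ℝ) {x : ℝ}
    (hr : IntervalIntegrable r volume 0 x) :
    AbsolutelyContinuousOnInterval (fun t => Real.exp (c * majorant a r t)) 0 x := by
  have h1 : AbsolutelyContinuousOnInterval (majorant a r) 0 x :=
    (intervalIntegrable_density hr).absolutelyContinuousOnInterval_intervalIntegral left_mem_uIcc
  obtain ⟨C, hC⟩ := h1.exists_bound
  -- The exponential is Lipschitz on the bounded range of `majorant`, so composing with it keeps
  -- absolute continuity.
  have h2 : ContDiffOn ℝ 1 (fun y : ℝ => Real.exp (c * y)) (Icc (-C) C) :=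
    ContDiff.contDiffOn (by fun_prop)
  obtain ⟨K, hK⟩ := h2.exists_lipschitzOnWith (by decide) (convex_Icc _ _) isCompact_Icc
  have hm : MapsTo (majorant a r) (uIcc 0 x) (Icc (-C) C) := fun y hy => by
    have := hC y hy
    rwa [Real.norm_eq_abs, abs_le] at this
  exact AbsolutelyContinuousOnInterval.comp_lipschitzOn (f := majorant a r)
    (g := fun y : ℝ => Real.exp (c * y)) h1 hK hm

theorem integral_density_mul_exp {c : ℝ} (hc : 0 < c) {x : ℝ}
    (hr : IntervalIntegrable r volume 0 x) :
    ∫ t in 0..x, 2 / a * (‖r t‖ + |t|) * Real.exp (c * majorant a r t) =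
      (Real.exp (c * majorant a r x) - 1) / c := by
  have h1 := (absolutelyContinuousOnInterval_exp_majorant (a := a) c hr).integral_deriv_eq_sub
  have h0 : majorant a r 0 = 0 := by simp [majorant]
  rw [h0, mul_zero, Real.exp_zero] at h1
  rw [eq_div_iff hc.ne', ← h1, ← intervalIntegral.integral_mul_const]
  refine intervalIntegral.integral_congr_ae ?_
  filter_upwards [(intervalIntegrable_density (a := a) hr).ae_hasDerivAt_integral] with t ht hm
  have h2 : HasDerivAt (majorant a r) _ t := ht (uIoc_subset_uIcc hm) 0 left_mem_uIcc
  rw [((h2.const_mul c).exp).deriv]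
  ring

theorem majorant_mono (ha : 0 < a) {x y : ℝ} (hx : 0 ≤ x) (hxy : x ≤ y)
    (hr : IntervalIntegrable r volume 0 y) : majorant a r x ≤ majorant a r y := by
  refine intervalIntegral.integral_mono_interval le_rfl hx hxy ?_ (intervalIntegrable_density hr)
  exact ae_of_all _ fun t => by positivity

theorem majorant_nonneg (ha : 0 < a) {x : ℝ} (hx : 0 ≤ x) : 0 ≤ majorant a r x :=
  intervalIntegral.integral_nonneg hx fun t _ => by positivity

/-- The constant `2/a` of `norm_volt_le` is built into the density of `majorant`, so the integral to
be estimated is that of the derivative of `exp (c * majorant)` divided by `c`. The factor `ρ` may be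
either `r` or the identity, the two coefficients in the recursion. -/
theorem norm_volt_mul_le (ha : 0 < a) {ρ f : ℝ → ℂ} {A c x : ℝ} (hc : 0 < c) (hx : 0 ≤ x)
    (hr : IntervalIntegrable r volume 0 x) (hρ : IntervalIntegrable ρ volume 0 x)
    (hρr : ∀ t ∈ Icc 0 x, ‖ρ t‖ ≤ ‖r t‖ + |t|) (hf : ContinuousOn f (Icc 0 x))
    (hA : ∀ t ∈ Icc 0 x, ‖f t‖ ≤ A * Real.exp (c * majorant a r t)) :
    ‖volt a (fun t => ρ t * f t) x‖ ≤ A / c * Real.exp (c * majorant a r x) := by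
  have hf' : ContinuousOn f (uIcc 0 x) := by rwa [uIcc_of_le hx]
  have hA0 : 0 ≤ A := by
    have := (norm_nonneg _).trans (hA 0 ⟨le_rfl, hx⟩)
    exact nonneg_of_mul_nonneg_left this (Real.exp_pos _)
  have hi : IntervalIntegrable (fun t => ρ t * f t) volume 0 x := hρ.mul_continuousOn hf'
  have he := (absolutelyContinuousOnInterval_exp_majorant (a := a) c hr).continuousOn
  calc _ ≤ 2 / a * ∫ t in 0..x, ‖ρ t * f t‖ := norm_volt_le ha hx hi
    _ = ∫ t in 0..x, 2 / a * ‖ρ t * f t‖ := (intervalIntegral.integral_const_mul _ _).symm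
    _ ≤ ∫ t in 0..x, A * (2 / a * (‖r t‖ + |t|) * Real.exp (c * majorant a r t)) := by
        refine intervalIntegral.integral_mono_on hx (hi.norm.const_mul _)
          (((intervalIntegrable_density hr).mul_continuousOn he).const_mul _) fun t ht => ?_
        rw [norm_mul]
        calc 2 / a * (‖ρ t‖ * ‖f t‖)
            ≤ 2 / a * ((‖r t‖ + |t|) * (A * Real.exp (c * majorant a r t))) := by
              gcongr
              · exact hρr t ht
              · exact hA t ht
          _ = _ := by ring
    _ = A * ((Real.exp (c * majorant a r x) - 1) / c) := by
        rw [intervalIntegral.integral_const_mul, integral_density_mul_exp hc hr]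
    _ ≤ A * (Real.exp (c * majorant a r x) / c) := by gcongr; linarith
    _ = _ := by ring

/-- Gronwall-type a priori bound for the Volterra equation. -/
theorem norm_le_of_volterra (ha : 0 < a) {w f : ℝ → ℂ} {A c b : ℝ} (hc : 2 ≤ c) (hb : 0 ≤ b)
    (hr : IntervalIntegrable r volume 0 b) (hw : ContinuousOn w (Icc 0 b))
    (hwf : ∀ x ∈ Icc 0 b, w x = f x + volt a (fun t => r t * w t) x)
    (hA : ∀ t ∈ Icc 0 b, ‖f t‖ ≤ A * Real.exp (c * majorant a r t)) :
    ∀ x ∈ Icc 0 b, ‖w x‖ ≤ 2 * A * Real.exp (c * majorant a r x) := by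
  have he : ContinuousOn (fun t => Real.exp (c * majorant a r t)) (Icc 0 b) := by
    have := (absolutelyContinuousOnInterval_exp_majorant (a := a) c hr).continuousOn
    rwa [uIcc_of_le hb] at this
  -- At a maximum point `y` of the weighted norm, the equation gives `B ≤ A + B/c ≤ A + B/2`. Since
  -- `B` is finite by compactness, it can be absorbed.
  obtain ⟨y, hy, hmax⟩ := isCompact_Icc.exists_isMaxOn ⟨0, left_mem_Icc.2 hb⟩
    (hw.norm.div he fun t _ => (Real.exp_pos _).ne')
  set B := ‖w y‖ / Real.exp (c * majorant a r y) with hB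
  have hwB : ∀ x ∈ Icc 0 b, ‖w x‖ ≤ B * Real.exp (c * majorant a r x) := fun x hx => by
    have := hmax hx
    simp only [mem_ofPred_eq] at this
    rwa [← div_le_iff₀ (Real.exp_pos _)]
  have hB0 : 0 ≤ B := by positivity
  have h1 : ‖w y‖ ≤ (A + B / 2) * Real.exp (c * majorant a r y) := by
    have hsub : Icc 0 y ⊆ Icc 0 b := Icc_subset_Icc_right hy.2
    have hry : IntervalIntegrable r volume 0 y :=
      hr.mono_set (by rwa [uIcc_of_le hy.1, uIcc_of_le hb])
    have h2 := norm_volt_mul_le ha (by linarith : 0 < c) hy.1 hry hry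
      (fun t _ => le_add_of_nonneg_right (abs_nonneg t)) (hw.mono hsub)
      (fun t ht => hwB t (hsub ht))
    have h3 : B / c ≤ B / 2 := by gcongr
    rw [hwf y hy]
    refine (norm_add_le _ _).trans ?_
    rw [add_mul]
    exact add_le_add (hA y hy) (h2.trans (by gcongr))
  have h2 : B ≤ A + B / 2 := by rwa [hB, div_le_iff₀ (Real.exp_pos _)]
  intro x hx
  refine (hwB x hx).trans ?_
  gcongr
  linarith

/-- The difference solves the homogeneous equation, so the a priori bound applies with `A = 0`. -/
theorem eqOn_of_volterra (ha : 0 < a) {w₁ w₂ f : ℝ → ℂ} {b : ℝ} (hb : 0 ≤ b)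
    (hr : IntervalIntegrable r volume 0 b) (hw₁ : ContinuousOn w₁ (Icc 0 b))
    (hw₂ : ContinuousOn w₂ (Icc 0 b))
    (h₁ : ∀ x ∈ Icc 0 b, w₁ x = f x + volt a (fun t => r t * w₁ t) x)
    (h₂ : ∀ x ∈ Icc 0 b, w₂ x = f x + volt a (fun t => r t * w₂ t) x) :
    EqOn w₁ w₂ (Icc 0 b) := by
  intro x hx
  have h := norm_le_of_volterra ha (w := fun t => w₁ t - w₂ t) (f := 0) (A := 0) (c := 2) le_rfl hb
    hr (hw₁.sub hw₂) (fun y hy => ?_) (fun t _ => by simp) x hx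
  · simp only [mul_zero, zero_mul, norm_le_zero_iff] at h
    exact sub_eq_zero.1 h
  · have hsub : uIcc 0 y ⊆ Icc 0 b := by rw [uIcc_of_le hy.1]; exact Icc_subset_Icc_right hy.2
    have hry : IntervalIntegrable r volume 0 y := hr.mono_set (by rwa [uIcc_of_le hb])
    have e : (fun t => r t * (w₁ t - w₂ t)) = fun t => r t * w₁ t + (-1) * (r t * w₂ t) := by
      ext t; ring
    rw [e, volt_add ha hy.1 (hry.mul_continuousOn (hw₁.mono hsub))
      ((hry.mul_continuousOn (hw₂.mono hsub)).const_mul _), volt_const_mul, h₁ y hy, h₂ y hy]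
    simp only [Pi.zero_apply]
    ring

end Majorant

/-! ### Neumann series and termwise integration -/

section Series

variable {a : ℝ}

theorem hasSum_integral_mul {g : ℝ → ℂ} {F : ℕ → ℝ → ℂ} {B : ℕ → ℝ} {x : ℝ} (hx : 0 ≤ x)
    (hg : IntervalIntegrable g volume 0 x) (hF : ∀ n, ContinuousOn (F n) (Icc 0 x))
    (hB : Summable B) (hFB : ∀ n, ∀ t ∈ Icc 0 x, ‖F n t‖ ≤ B n) :
    HasSum (fun n => ∫ t in 0..x, g t * F n t) (∫ t in 0..x, g t * ∑' n, F n t) := by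
  have hsub : uIoc 0 x ⊆ Icc 0 x := by rw [uIoc_of_le hx]; exact Ioc_subset_Icc_self
  refine intervalIntegral.hasSum_integral_of_dominated_convergence (fun n t => ‖g t‖ * B n)
    (fun n => ?_) (fun n => ae_of_all _ fun t ht => ?_) (ae_of_all _ fun t _ => hB.mul_left _) ?_
    (ae_of_all _ fun t ht => ?_)
  · have : IntervalIntegrable (fun t => g t * F n t) volume 0 x :=
      hg.mul_continuousOn (by rw [uIcc_of_le hx]; exact hF n)
    rw [uIoc_of_le hx]
    exact this.1.aestronglyMeasurable
  · rw [norm_mul]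
    gcongr
    exact hFB n t (hsub ht)
  · simp_rw [tsum_mul_left]
    exact hg.norm.mul_const _
  · exact (Summable.of_norm_bounded hB fun n => hFB n t (hsub ht)).hasSum.mul_left _

theorem hasSum_hardy_mul {α : ℝ} (hα : 0 ≤ α) {g : ℝ → ℂ} {F : ℕ → ℝ → ℂ} {B : ℕ → ℝ} {x : ℝ}
    (hx : 0 ≤ x) (hg : IntervalIntegrable g volume 0 x) (hF : ∀ n, ContinuousOn (F n) (Icc 0 x))
    (hB : Summable B) (hFB : ∀ n, ∀ t ∈ Icc 0 x, ‖F n t‖ ≤ B n) :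
    HasSum (fun n => hardy α (fun t => g t * F n t) x)
      (hardy α (fun t => g t * ∑' n, F n t) x) := by
  simp only [hardy, ← mul_assoc]
  exact (hasSum_integral_mul hx (intervalIntegrable_rpow_mul hα hg) hF hB hFB).mul_left _

theorem hasSum_volt_mul (ha : 0 < a) {g : ℝ → ℂ} {F : ℕ → ℝ → ℂ} {B : ℕ → ℝ} {x : ℝ}
    (hx : 0 ≤ x) (hg : IntervalIntegrable g volume 0 x) (hF : ∀ n, ContinuousOn (F n) (Icc 0 x))
    (hB : Summable B) (hFB : ∀ n, ∀ t ∈ Icc 0 x, ‖F n t‖ ≤ B n) :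
    HasSum (fun n => volt a (fun t => g t * F n t) x)
      (volt a (fun t => g t * ∑' n, F n t) x) := by
  have ha' : (a : ℂ) ≠ 0 := by exact_mod_cast ha.ne'
  have hI : ∀ G : ℝ → ℂ, ContinuousOn G (Icc 0 x) →
      IntervalIntegrable (fun t => g t * G t) volume 0 x := fun G hG =>
    hg.mul_continuousOn (by rwa [uIcc_of_le hx])
  rw [← hasSum_mul_left_iff ha', mul_volt ha hx (hI _ (continuousOn_tsum hF hB hFB))]
  simp only [fun n => mul_volt ha hx (hI _ (hF n))]
  exact (hasSum_integral_mul hx hg hF hB hFB).sub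
    ((hasSum_hardy_mul ha.le hx hg hF hB hFB).mul_left _)

theorem continuousOn_Ici_of_Icc {f : ℝ → ℂ} (h : ∀ b, 0 ≤ b → ContinuousOn f (Icc 0 b)) :
    ContinuousOn f (Ici 0) := by
  intro x hx
  have hx0 : (0:ℝ) ≤ x := hx
  refine (h (x + 1) (by linarith) x ⟨hx, by linarith⟩).mono_of_mem_nhdsWithin ?_
  rw [← Ici_inter_Iic]
  exact inter_mem self_mem_nhdsWithin (mem_nhdsWithin_of_mem_nhds (Iic_mem_nhds (by linarith)))

theorem intervalIntegrable_mul_of_continuousOn {r f : ℝ → ℂ}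
    (hr : ∀ b, 0 ≤ b → IntervalIntegrable r volume 0 b) (hf : ContinuousOn f (Ici 0)) :
    ∀ b, 0 ≤ b → IntervalIntegrable (fun t => r t * f t) volume 0 b := fun b hb =>
  (hr b hb).mul_continuousOn (hf.mono (by rw [uIcc_of_le hb]; exact Icc_subset_Ici_self))

/-- Solvability of the Volterra equation by a Neumann series. -/
theorem exists_volterra (ha : 0 < a) {r : ℝ → ℂ}
    (hr : ∀ b, 0 ≤ b → IntervalIntegrable r volume 0 b) (f : ℝ → ℂ)
    (hf : ContinuousOn f (Ici 0)) :
    ∃ w : ℝ → ℂ, ContinuousOn w (Ici 0) ∧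
      ∀ x, 0 ≤ x → w x = f x + volt a (fun t => r t * w t) x := by
  let F : ℕ → ℝ → ℂ := fun n => (fun g => volt a (fun t => r t * g t))^[n] f
  have hF0 : F 0 = f := rfl
  have hFs : ∀ n, F (n + 1) = volt a (fun t => r t * F n t) := fun n =>
    Function.iterate_succ_apply' _ _ _
  have hFc : ∀ n, ContinuousOn (F n) (Ici 0) := by
    intro n
    induction n with
    | zero => exact hf
    | succ n ih =>
      rw [hFs]
      exact volt_continuousOn ha (intervalIntegrable_mul_of_continuousOn hr ih)
  have hbound : ∀ b, 0 ≤ b → ∃ B : ℕ → ℝ, Summable B ∧ ∀ n, ∀ t ∈ Icc 0 b, ‖F n t‖ ≤ B n := by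
    intro b hb
    obtain ⟨C, hC⟩ := isCompact_Icc.exists_bound_of_continuousOn
      (hf.mono (Icc_subset_Ici_self : Icc 0 b ⊆ Ici 0))
    have hC0 : 0 ≤ C := (norm_nonneg _).trans (hC 0 ⟨le_rfl, hb⟩)
    -- With `c = 2`, each application of the operator halves the weighted norm.
    have h1 : ∀ n, ∀ t ∈ Icc 0 b, ‖F n t‖ ≤ C / 2 ^ n * Real.exp (2 * majorant a r t) := by
      intro n
      induction n with
      | zero =>
        intro t ht
        have : 1 ≤ Real.exp (2 * majorant a r t) :=
          Real.one_le_exp (by have := majorant_nonneg (r := r) ha ht.1; linarith)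
        rw [hF0, pow_zero, div_one]
        exact (hC t ht).trans (le_mul_of_one_le_right hC0 this)
      | succ n ih =>
        intro t ht
        rw [hFs]
        refine (norm_volt_mul_le ha two_pos ht.1 (hr t ht.1) (hr t ht.1)
          (fun s _ => le_add_of_nonneg_right (abs_nonneg s))
          ((hFc n).mono Icc_subset_Ici_self)
          (fun s hs => ih s ⟨hs.1, hs.2.trans ht.2⟩)).trans (le_of_eq ?_)
        rw [pow_succ, div_div]
    refine ⟨fun n => C * Real.exp (2 * majorant a r b) * (1 / 2) ^ n,
      (summable_geometric_two).mul_left _, fun n t ht => (h1 n t ht).trans ?_⟩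
    have := majorant_mono ha ht.1 ht.2 (hr b hb)
    calc C / 2 ^ n * Real.exp (2 * majorant a r t)
        ≤ C / 2 ^ n * Real.exp (2 * majorant a r b) := by gcongr
      _ = C * Real.exp (2 * majorant a r b) * (1 / 2) ^ n := by rw [one_div, inv_pow]; ring
  refine ⟨fun t => ∑' n, F n t, continuousOn_Ici_of_Icc fun b hb => ?_, fun x hx => ?_⟩
  · obtain ⟨B, hB, hFB⟩ := hbound b hb
    exact continuousOn_tsum (fun n => (hFc n).mono Icc_subset_Ici_self) hB hFB
  · obtain ⟨B, hB, hFB⟩ := hbound x hx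
    have hs : Summable fun n => F n x :=
      Summable.of_norm_bounded hB fun n => hFB n x ⟨hx, le_rfl⟩
    simp only
    rw [hs.tsum_eq_zero_add, hF0]
    congr 1
    simp only [hFs]
    exact (hasSum_volt_mul ha hx (hr x hx) (fun n => (hFc n).mono Icc_subset_Ici_self) hB
      hFB).tsum_eq

end Series

/-- The inhomogeneity of the `k`-th equation obtained by expanding `v = 1 + volt a ((s - ζ t) v)`
in powers of `ζ`. -/
def source (s : ℝ → ℂ) (v : ℕ → ℝ → ℂ) : ℕ → ℝ → ℂ
  | 0, t => s t * v 0 t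
  | k + 1, t => s t * v (k + 1) t - t * v k t

/-- `v k` are the Taylor coefficients in `ζ` of the solution of `v = 1 + volt a ((s - ζ t) v)`. -/
structure IsExpansion (a : ℝ) (s : ℝ → ℂ) (v : ℕ → ℝ → ℂ) : Prop where
  continuousOn : ∀ k, ContinuousOn (v k) (Ici 0)
  eq : ∀ k, ∀ x, 0 ≤ x → v k x = (if k = 0 then 1 else 0) + volt a (source s v k) x

/-! ### Expansion of the Volterra solution in the spectral parameter -/

section Expansion

variable {a : ℝ} {s : ℝ → ℂ} {v : ℕ → ℝ → ℂ}

theorem intervalIntegrable_id_mul {f : ℝ → ℂ} (hf : ContinuousOn f (Ici 0)) :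
    ∀ b, 0 ≤ b → IntervalIntegrable (fun t : ℝ => (t : ℂ) * f t) volume 0 b :=
  intervalIntegrable_mul_of_continuousOn
    (fun _ _ => Complex.continuous_ofReal.intervalIntegrable _ _) hf

theorem IsExpansion.intervalIntegrable_source (hs : ∀ b, 0 ≤ b → IntervalIntegrable s volume 0 b)
    (hv : IsExpansion a s v) (k : ℕ) :
    ∀ b, 0 ≤ b → IntervalIntegrable (source s v k) volume 0 b := by
  intro b hb
  cases k with
  | zero => exact intervalIntegrable_mul_of_continuousOn hs (hv.continuousOn 0) b hb
  | succ k =>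
    exact (intervalIntegrable_mul_of_continuousOn hs (hv.continuousOn (k + 1)) b hb).sub
      (intervalIntegrable_id_mul (hv.continuousOn k) b hb)

theorem volt_source_succ {k : ℕ} (ha : 0 < a) {x : ℝ} (hx : 0 ≤ x)
    (h₁ : IntervalIntegrable (fun t => s t * v (k + 1) t) volume 0 x)
    (h₂ : IntervalIntegrable (fun t : ℝ => (t : ℂ) * v k t) volume 0 x) :
    volt a (source s v (k + 1)) x =
      volt a (fun t => s t * v (k + 1) t) x - volt a (fun t : ℝ => (t : ℂ) * v k t) x := by
  have : source s v (k + 1) = fun t => s t * v (k + 1) t + (-1) * ((t : ℂ) * v k t) := by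
    ext t; simp only [source]; ring
  rw [this, volt_add ha hx h₁ (h₂.const_mul _), volt_const_mul]
  ring

theorem hardy_source_succ {α : ℝ} {k : ℕ} (hα : 0 ≤ α) {x : ℝ}
    (h₁ : IntervalIntegrable (fun t => s t * v (k + 1) t) volume 0 x)
    (h₂ : IntervalIntegrable (fun t : ℝ => (t : ℂ) * v k t) volume 0 x) :
    hardy α (source s v (k + 1)) x =
      hardy α (fun t => s t * v (k + 1) t) x - hardy α (fun t : ℝ => (t : ℂ) * v k t) x := by
  have : source s v (k + 1) = fun t => s t * v (k + 1) t + (-1) * ((t : ℂ) * v k t) := by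
    ext t; simp only [source]; ring
  rw [this, hardy_add hα h₁ (h₂.const_mul _), hardy_const_mul]
  ring

theorem exists_isExpansion (ha : 0 < a) (hs : ∀ b, 0 ≤ b → IntervalIntegrable s volume 0 b) :
    ∃ v, IsExpansion a s v := by
  have key : ∀ f : {f : ℝ → ℂ // ContinuousOn f (Ici 0)}, ∃ w : {f : ℝ → ℂ // ContinuousOn f (Ici 0)},
      ∀ x, 0 ≤ x → w.1 x = -volt a (fun t : ℝ => (t : ℂ) * f.1 t) x +
        volt a (fun t => s t * w.1 t) x := fun f => by
    obtain ⟨w, hw, hw'⟩ := exists_volterra ha hs (fun x => -volt a (fun t : ℝ => (t : ℂ) * f.1 t) x)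
      (volt_continuousOn ha (intervalIntegrable_id_mul f.2)).neg
    exact ⟨⟨w, hw⟩, hw'⟩
  choose step hstep using key
  obtain ⟨v₀, hv₀, hv₀'⟩ := exists_volterra ha hs (fun _ => 1) continuousOn_const
  let v : ℕ → {f : ℝ → ℂ // ContinuousOn f (Ici 0)} := fun k => step^[k] ⟨v₀, hv₀⟩
  have hvs : ∀ k, v (k + 1) = step (v k) := fun k => Function.iterate_succ_apply' _ _ _
  refine ⟨fun k => (v k).1, fun k => (v k).2, fun k x hx => ?_⟩
  cases k with
  | zero => exact hv₀' x hx
  | succ k =>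
    have h := hstep (v k) x hx
    rw [← hvs] at h
    have h1 : IntervalIntegrable (fun t => s t * (v (k + 1)).1 t) volume 0 x :=
      intervalIntegrable_mul_of_continuousOn hs (v (k + 1)).2 x hx
    have h2 : IntervalIntegrable (fun t : ℝ => (t : ℂ) * (v k).1 t) volume 0 x :=
      intervalIntegrable_id_mul (v k).2 x hx
    rw [volt_source_succ (v := fun k => (v k).1) ha hx h1 h2, h]
    simp only [Nat.add_eq_zero_iff, one_ne_zero, and_false, if_false]
    ring

theorem IsExpansion.eq_zero (hv : IsExpansion a s v) {x : ℝ} (hx : 0 ≤ x) :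
    v 0 x = 1 + volt a (fun t => s t * v 0 t) x := by
  simpa using! hv.eq 0 x hx

theorem IsExpansion.eq_succ (hv : IsExpansion a s v) (ha : 0 < a)
    (hs : ∀ b, 0 ≤ b → IntervalIntegrable s volume 0 b) (k : ℕ) {x : ℝ} (hx : 0 ≤ x) :
    v (k + 1) x = -volt a (fun t : ℝ => (t : ℂ) * v k t) x +
      volt a (fun t => s t * v (k + 1) t) x := by
  rw [hv.eq (k + 1) x hx, volt_source_succ ha hx
    (intervalIntegrable_mul_of_continuousOn hs (hv.continuousOn (k + 1)) x hx)
    (intervalIntegrable_id_mul (hv.continuousOn k) x hx)]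
  simp only [Nat.add_eq_zero_iff, one_ne_zero, and_false, if_false]
  ring

/-- Passing from `v k` to `v (k + 1)` costs `1/c` for integrating against `t`, and `2` for solving
the Volterra equation. As `c` is free, the coefficients decay faster than any geometric sequence. -/
theorem IsExpansion.norm_le (hv : IsExpansion a s v) (ha : 0 < a)
    (hs : ∀ b, 0 ≤ b → IntervalIntegrable s volume 0 b) {c : ℝ} (hc : 2 ≤ c) (k : ℕ) {x : ℝ} (hx : 0 ≤ x) :
    ‖v k x‖ ≤ 2 * (2 / c) ^ k * Real.exp (c * majorant a s x) := by
  have hc0 : 0 < c := by linarith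
  induction k generalizing x with
  | zero =>
    have h := norm_le_of_volterra ha (f := fun _ => 1) (A := 1) hc hx (hs x hx)
      ((hv.continuousOn 0).mono Icc_subset_Ici_self) (fun y hy => hv.eq_zero hy.1)
      (fun t ht => by
        rw [norm_one, one_mul]
        exact Real.one_le_exp (mul_nonneg hc0.le (majorant_nonneg ha ht.1))) x ⟨hx, le_rfl⟩
    simpa using h
  | succ k ih =>
    have h := norm_le_of_volterra ha (A := (2 / c) ^ (k + 1)) hc hx (hs x hx)
      ((hv.continuousOn (k + 1)).mono Icc_subset_Ici_self)
      (fun y hy => hv.eq_succ ha hs k hy.1)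
      (fun t ht => by
        rw [norm_neg]
        have h1 := norm_volt_mul_le ha hc0 ht.1 (hs t ht.1)
          (Complex.continuous_ofReal.intervalIntegrable 0 t) (fun y _ => by
            rw [Complex.norm_real, Real.norm_eq_abs]
            exact le_add_of_nonneg_left (norm_nonneg _))
          ((hv.continuousOn k).mono Icc_subset_Ici_self) (fun y hy => ih hy.1)
        refine h1.trans (le_of_eq ?_)
        rw [pow_succ]; ring) x ⟨hx, le_rfl⟩
    exact h

theorem IsExpansion.exists_bound (hv : IsExpansion a s v) (ha : 0 < a)
    (hs : ∀ b, 0 ≤ b → IntervalIntegrable s volume 0 b) (ζ : ℂ) {b : ℝ} (hb : 0 ≤ b) :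
    ∃ B : ℕ → ℝ, Summable B ∧ ∀ k, ∀ t ∈ Icc 0 b, ‖ζ ^ k * v k t‖ ≤ B k := by
  -- Chosen so that `‖ζ‖ * (2 / c) ≤ 1 / 2`, which makes the bounds geometric.
  set c : ℝ := 4 * (‖ζ‖ + 1) with hcdef
  have hζ := norm_nonneg ζ
  have hc : 2 ≤ c := by linarith
  refine ⟨fun k => 2 * Real.exp (c * majorant a s b) * (1 / 2) ^ k,
    summable_geometric_two.mul_left _, fun k t ht => ?_⟩
  have h1 := hv.norm_le ha hs hc k ht.1
  have h2 := majorant_mono ha ht.1 ht.2 (hs b hb)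
  have h3 : ‖ζ‖ * (2 / c) ≤ 1 / 2 := by
    rw [hcdef, mul_div_assoc', div_le_div_iff₀ (by positivity) two_pos]
    linarith
  rw [norm_mul, norm_pow]
  calc ‖ζ‖ ^ k * ‖v k t‖ ≤ ‖ζ‖ ^ k * (2 * (2 / c) ^ k * Real.exp (c * majorant a s b)) := by
        refine mul_le_mul_of_nonneg_left (h1.trans ?_) (by positivity)
        have hc0 : 0 < c := by linarith
        gcongr
    _ = 2 * Real.exp (c * majorant a s b) * (‖ζ‖ * (2 / c)) ^ k := by rw [mul_pow]; ring
    _ ≤ _ := by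
        have hc0 : 0 < c := by linarith
        exact mul_le_mul_of_nonneg_left (pow_le_pow_left₀ (by positivity) h3 k) (by positivity)

theorem IsExpansion.hasSum (hv : IsExpansion a s v) (ha : 0 < a)
    (hs : ∀ b, 0 ≤ b → IntervalIntegrable s volume 0 b) (ζ : ℂ) {x : ℝ} (hx : 0 ≤ x) :
    HasSum (fun k => ζ ^ k * v k x) (∑' k, ζ ^ k * v k x) := by
  obtain ⟨B, hB, h⟩ := hv.exists_bound ha hs ζ hx
  exact (Summable.of_norm_bounded hB fun n => h n x ⟨hx, le_rfl⟩).hasSum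

theorem IsExpansion.continuousOn_tsum (hv : IsExpansion a s v) (ha : 0 < a)
    (hs : ∀ b, 0 ≤ b → IntervalIntegrable s volume 0 b) (ζ : ℂ) :
    ContinuousOn (fun x => ∑' k, ζ ^ k * v k x) (Ici 0) :=
  continuousOn_Ici_of_Icc fun b hb => by
    obtain ⟨B, hB, h⟩ := hv.exists_bound ha hs ζ hb
    exact _root_.continuousOn_tsum (fun n => continuousOn_const.mul
      ((hv.continuousOn n).mono Icc_subset_Ici_self)) hB h

/-- Generating-function form of `C = A - ζ B`: it turns the recursion in `source` into the factor `s
- ζ t`. -/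
theorem hasSum_shift {A B C : ℕ → ℂ} {α β ζ : ℂ} (h0 : C 0 = A 0)
    (h1 : ∀ k, C (k + 1) = A (k + 1) - B k) (hA : HasSum (fun k => ζ ^ k * A k) α)
    (hB : HasSum (fun k => ζ ^ k * B k) β) : HasSum (fun k => ζ ^ k * C k) (α - ζ * β) := by
  have h2 : HasSum (fun k => ζ ^ (k + 1) * A (k + 1)) (α - A 0) := by
    simpa using (hasSum_nat_add_iff' 1).2 hA
  have h3 := h2.sub (hB.mul_left ζ)
  have h4 : HasSum (fun k => ζ ^ (k + 1) * C (k + 1)) (α - A 0 - ζ * β) := by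
    refine h3.congr_fun fun k => ?_
    rw [h1]; ring
  have h5 := h4.zero_add (f := fun k => ζ ^ k * C k)
  convert h5 using 1
  rw [pow_zero, h0]; ring

theorem IsExpansion.hasSum_hardy_source (hv : IsExpansion a s v) (ha : 0 < a)
    (hs : ∀ b, 0 ≤ b → IntervalIntegrable s volume 0 b) (ζ : ℂ) {x : ℝ} (hx : 0 ≤ x) :
    HasSum (fun k => ζ ^ k * hardy a (source s v k) x)
      (hardy a (fun t => (s t - ζ * t) * ∑' k, ζ ^ k * v k t) x) := by
  obtain ⟨B, hB, h⟩ := hv.exists_bound ha hs ζ hx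
  have hc : ∀ n, ContinuousOn (fun t => ζ ^ n * v n t) (Icc 0 x) := fun n =>
    continuousOn_const.mul ((hv.continuousOn n).mono Icc_subset_Ici_self)
  have h1 := hasSum_hardy_mul ha.le hx (hs x hx) hc hB h
  have h2 := hasSum_hardy_mul ha.le hx (Complex.continuous_ofReal.intervalIntegrable 0 x) hc hB h
  have e : ∀ (g : ℝ → ℂ) n, hardy a (fun t => g t * (ζ ^ n * v n t)) x =
      ζ ^ n * hardy a (fun t => g t * v n t) x := fun g n => by
    rw [← hardy_const_mul]; congr 1; ext t; ring
  simp only [e] at h1 h2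
  have h3 := hasSum_shift (C := fun k => hardy a (source s v k) x) rfl (fun k =>
    hardy_source_succ ha.le
    (intervalIntegrable_mul_of_continuousOn hs (hv.continuousOn (k + 1)) x hx)
    (intervalIntegrable_id_mul (hv.continuousOn k) x hx)) h1 h2
  convert h3 using 1
  have hS := hv.continuousOn_tsum ha hs ζ
  rw [sub_eq_add_neg, ← neg_mul, ← hardy_const_mul, ← hardy_add ha.le
    (intervalIntegrable_mul_of_continuousOn hs hS x hx)
    ((intervalIntegrable_id_mul hS x hx).const_mul _)]
  congr 1; ext t; ring

theorem IsExpansion.tsum_eq (hv : IsExpansion a s v) (ha : 0 < a)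
    (hs : ∀ b, 0 ≤ b → IntervalIntegrable s volume 0 b) (ζ : ℂ) {x : ℝ} (hx : 0 ≤ x) :
    ∑' k, ζ ^ k * v k x = 1 + volt a (fun t => (s t - ζ * t) * ∑' k, ζ ^ k * v k t) x := by
  obtain ⟨B, hB, h⟩ := hv.exists_bound ha hs ζ hx
  have hc : ∀ n, ContinuousOn (fun t => ζ ^ n * v n t) (Icc 0 x) := fun n =>
    continuousOn_const.mul ((hv.continuousOn n).mono Icc_subset_Ici_self)
  have h1 := hasSum_volt_mul ha hx (hs x hx) hc hB h
  have h2 := hasSum_volt_mul ha hx (Complex.continuous_ofReal.intervalIntegrable 0 x) hc hB h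
  have e : ∀ (g : ℝ → ℂ) n, volt a (fun t => g t * (ζ ^ n * v n t)) x =
      ζ ^ n * volt a (fun t => g t * v n t) x := fun g n => by
    rw [← volt_const_mul]; congr 1; ext t; ring
  simp only [e] at h1 h2
  have h3 := hasSum_shift (C := fun k => volt a (source s v k) x) rfl (fun k =>
    volt_source_succ ha hx
    (intervalIntegrable_mul_of_continuousOn hs (hv.continuousOn (k + 1)) x hx)
    (intervalIntegrable_id_mul (hv.continuousOn k) x hx)) h1 h2
  have hS := hv.continuousOn_tsum ha hs ζ
  rw [sub_eq_add_neg, ← neg_mul, ← volt_const_mul, ← volt_add ha hx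
    (intervalIntegrable_mul_of_continuousOn hs hS x hx)
    ((intervalIntegrable_id_mul hS x hx).const_mul _)] at h3
  have h4 : HasSum (fun k => ζ ^ k * if k = 0 then (1:ℂ) else 0) 1 := by
    convert hasSum_ite_eq (0:ℕ) (1:ℂ) using 2 with k
    split_ifs with hk <;> simp [hk]
  have h5 := (h4.add h3).tsum_eq
  simp only [← mul_add, ← fun k => hv.eq k x hx] at h5
  rw [h5]
  congr 2; ext t; ring

/-- Applying `volt a` to `t v_k` gains two powers of `x`: one from the factor `t`, one from the
integration. Solving the Volterra equation does not change the order of vanishing. -/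
theorem IsExpansion.exists_norm_le_pow (hv : IsExpansion a s v) (ha : 0 < a)
    (hs : ∀ b, 0 ≤ b → IntervalIntegrable s volume 0 b) (k : ℕ) :
    ∃ C, 0 ≤ C ∧ ∀ x ∈ Icc (0:ℝ) 1, ‖v k x‖ ≤ C * x ^ (2 * k) := by
  induction k with
  | zero =>
    obtain ⟨C, hC⟩ := isCompact_Icc.exists_bound_of_continuousOn
      ((hv.continuousOn 0).mono (Icc_subset_Ici_self : Icc (0:ℝ) 1 ⊆ Ici 0))
    exact ⟨C, (norm_nonneg _).trans (hC 0 ⟨le_rfl, zero_le_one⟩), by simpa using hC⟩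
  | succ k ih =>
    obtain ⟨C, hC0, hC⟩ := ih
    refine ⟨2 * (2 / a * C) * Real.exp (2 * majorant a s 1), by positivity, fun x hx => ?_⟩
    -- The point `x` is fixed and the bound used on `[0, x]` only, so `A` may contain the power of
    -- the endpoint.
    have h := norm_le_of_volterra ha (A := 2 / a * C * x ^ (2 * (k + 1))) le_rfl hx.1 (hs x hx.1)
      ((hv.continuousOn (k + 1)).mono Icc_subset_Ici_self)
      (fun y hy => hv.eq_succ ha hs k hy.1)
      (fun t ht => by
        have hi := intervalIntegrable_id_mul (hv.continuousOn k) t ht.1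
        have h1 : ∫ y in 0..t, ‖(y : ℂ) * v k y‖ ≤ C * x ^ (2 * (k + 1)) := by
          calc _ ≤ ∫ y in 0..t, C * x ^ (2 * k + 1) := by
                refine intervalIntegral.integral_mono_on ht.1 hi.norm (by simp) fun y hy => ?_
                have hyx : y ≤ x := hy.2.trans ht.2
                rw [norm_mul, Complex.norm_real, Real.norm_of_nonneg hy.1]
                calc y * ‖v k y‖ ≤ x * (C * x ^ (2 * k)) := by
                      have := hC y ⟨hy.1, hyx.trans hx.2⟩
                      have h0 := hy.1
                      have h0' := hx.1
                      gcongr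
                      exact this.trans (by gcongr)
                  _ = _ := by ring
            _ = t * (C * x ^ (2 * k + 1)) := by simp; ring
            _ ≤ x * (C * x ^ (2 * k + 1)) := by
                have h0' := hx.1
                gcongr
                exact ht.2
            _ = _ := by ring
        rw [norm_neg]
        calc _ ≤ 2 / a * ∫ y in 0..t, ‖(y : ℂ) * v k y‖ := norm_volt_le ha ht.1 hi
          _ ≤ 2 / a * (C * x ^ (2 * (k + 1))) := by gcongr
          _ = 2 / a * C * x ^ (2 * (k + 1)) * 1 := by ring
          _ ≤ _ := by
            have h0' := hx.1
            gcongr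
            exact Real.one_le_exp (mul_nonneg two_pos.le (majorant_nonneg ha ht.1)))
      x ⟨hx.1, le_rfl⟩
    have h2 := majorant_mono ha hx.1 hx.2 (hs 1 zero_le_one)
    have h0' := hx.1
    calc _ ≤ _ := h
      _ ≤ 2 * (2 / a * C * x ^ (2 * (k + 1))) * Real.exp (2 * majorant a s 1) := by gcongr
      _ = _ := by ring

end Expansion

/-- `F` is on `(0,1]` a primitive of an `L^p` function with boundary value `c` at `0`. -/
def HasPrimitive (p : ℝ≥0∞) (c : ℂ) (F : ℝ → ℂ) : Prop :=
  ∃ g : ℝ → ℂ, MemLp g p (volume.restrict (Ioo 0 1)) ∧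
    ∀ x ∈ Ioc (0:ℝ) 1, F x = c + ∫ t in 0..x, g t

theorem intervalIntegrable_of_memLp {p : ℝ≥0∞} (hp : 1 ≤ p) {g : ℝ → ℂ}
    (hg : MemLp g p (volume.restrict (Ioo (0:ℝ) 1))) {x : ℝ} (hx : x ∈ Icc (0:ℝ) 1) :
    IntervalIntegrable g volume 0 x := by
  have : IntervalIntegrable g volume 0 1 := by
    rw [intervalIntegrable_iff_integrableOn_Ioo_of_le zero_le_one]
    exact hg.integrable hp
  exact this.mono_set (by
    rw [uIcc_of_le hx.1, uIcc_of_le zero_le_one]; exact Icc_subset_Icc_right hx.2)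

/-! ### `W^{1,p}` functions with prescribed boundary value at `0` -/

section HasPrimitive

variable {p : ℝ≥0∞} {c d : ℂ} {F G : ℝ → ℂ}

theorem HasPrimitive.congr (hF : HasPrimitive p c F) (h : EqOn F G (Ioc 0 1)) :
    HasPrimitive p c G := by
  obtain ⟨g, hg, hFg⟩ := hF
  exact ⟨g, hg, fun x hx => by rw [← h hx, hFg x hx]⟩

theorem HasPrimitive.add (hp : 1 ≤ p) (hF : HasPrimitive p c F) (hG : HasPrimitive p d G) :
    HasPrimitive p (c + d) (fun x => F x + G x) := by
  obtain ⟨f, hf, hFf⟩ := hF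
  obtain ⟨g, hg, hGg⟩ := hG
  refine ⟨fun x => f x + g x, hf.add hg, fun x hx => ?_⟩
  have hx' := Ioc_subset_Icc_self hx
  change F x + G x = _
  rw [intervalIntegral.integral_add (intervalIntegrable_of_memLp hp hf hx')
    (intervalIntegrable_of_memLp hp hg hx'), hFf x hx, hGg x hx]
  ring

theorem HasPrimitive.const_mul (k : ℂ) (hF : HasPrimitive p c F) :
    HasPrimitive p (k * c) (fun x => k * F x) := by
  obtain ⟨f, hf, hFf⟩ := hF
  refine ⟨fun x => k * f x, hf.const_mul k, fun x hx => ?_⟩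
  change k * F x = _
  rw [intervalIntegral.integral_const_mul, hFf x hx, mul_add]

theorem HasPrimitive.memW1p (hp : 1 ≤ p) (hF : HasPrimitive p (F 0) F) : MemW1p p F := by
  obtain ⟨g, hg, hFg⟩ := hF
  have hi := intervalIntegrable_of_memLp hp hg (right_mem_Icc.2 zero_le_one)
  have hFg' : ∀ x ∈ Icc (0:ℝ) 1, F x = F 0 + ∫ t in 0..x, g t := fun x hx => by
    rcases hx.1.eq_or_lt with h | h
    · subst h; simp
    · exact hFg x ⟨h, hx.2⟩
  refine ⟨((absolutelyContinuousOnInterval_const (F 0) 0 1).fun_add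
    (absolutelyContinuousOnInterval_integral hi left_mem_uIcc)).congr_eqOn fun x hx => ?_, ?_⟩
  · rw [uIcc_of_le zero_le_one] at hx
    exact (hFg' x hx).symm
  · refine (memLp_congr_ae ?_).2 hg
    rw [Filter.EventuallyEq, ae_restrict_iff' measurableSet_Ioo]
    filter_upwards [hi.ae_hasDerivAt_integral] with x hx hm
    have h1 := (hx (by rw [uIcc_of_le zero_le_one]; exact Ioo_subset_Icc_self hm) 0
      left_mem_uIcc).const_add (F 0)
    refine (h1.congr_of_eventuallyEq ?_).deriv
    filter_upwards [Ioo_mem_nhds hm.1 hm.2] with y hy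
    exact hFg' y (Ioo_subset_Icc_self hy)

theorem HasPrimitive.tendsto (hp : 1 ≤ p) (hF : HasPrimitive p c F) :
    Tendsto F (𝓝[>] 0) (𝓝 c) := by
  obtain ⟨g, hg, hFg⟩ := hF
  have hi := intervalIntegrable_of_memLp hp hg (right_mem_Icc.2 zero_le_one)
  have h1 := (absolutelyContinuousOnInterval_integral hi left_mem_uIcc).continuousOn 0
    left_mem_uIcc
  rw [ContinuousWithinAt, intervalIntegral.integral_same, uIcc_of_le zero_le_one] at h1
  have h2 : Tendsto (fun x => ∫ t in 0..x, g t) (𝓝[>] 0) (𝓝 0) := by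
    rw [← nhdsWithin_Ioc_eq_nhdsGT zero_lt_one]
    exact h1.mono_left (nhdsWithin_mono _ Ioc_subset_Icc_self)
  have h3 := h2.const_add c
  rw [add_zero] at h3
  refine h3.congr' ?_
  filter_upwards [Ioc_mem_nhdsGT zero_lt_one] with x hx
  exact (hFg x hx).symm

variable {α : ℝ}

theorem hasPrimitive_mul_hardy (hα : 0 < α) (hp : 1 ≤ p) {f : ℝ → ℂ}
    (hf : MemLp f p (volume.restrict (Ioo 0 1))) :
    HasPrimitive p 0 (fun x => (x : ℂ) * hardy α f x) := by
  refine ⟨fun t => f t - α * hardy α f t,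
    hf.sub ((memLp_hardy hα zero_le_one hp hf).const_mul _), fun x hx => ?_⟩
  rw [zero_add, integral_sub_hardy hα hx.1.le
    (intervalIntegrable_of_memLp hp hf (Ioc_subset_Icc_self hx))]

/-- Integration by parts and `mul_volt` give `hardy (α - 1) F = c/α + volt α g`, so the new
derivative is `hardy α g`, in `L^p` by Hardy's inequality. -/
theorem HasPrimitive.hardy (hα : 0 < α) (hp : 1 ≤ p) (hF : HasPrimitive p c F) :
    HasPrimitive p (c / α) (hardy (α - 1) F) := by
  obtain ⟨g, hg, hFg⟩ := hF
  refine ⟨PerturbedBessel.hardy α g, memLp_hardy hα zero_le_one hp hg, fun x hx => ?_⟩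
  have hi := intervalIntegrable_of_memLp hp hg (right_mem_Icc.2 zero_le_one)
  have hx' := Ioc_subset_Icc_self hx
  have hα' : (α : ℂ) ≠ 0 := by exact_mod_cast hα.ne'
  have h1 := hardy_sub_one_of_primitive hα (F := fun x => c + ∫ t in 0..x, g t) hi
    (fun _ _ => rfl) hx
  have h2 := mul_volt hα hx.1.le (intervalIntegrable_of_memLp hp hg hx')
  rw [hardy_congr hx.1.le (fun y hy => hFg y ⟨hy.1, hy.2.trans hx.2⟩)]
  apply mul_left_cancel₀ hα'
  rw [h1, mul_add, mul_div_cancel₀ _ hα']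
  rw [volt] at h2
  rw [h2]
  ring

end HasPrimitive

theorem hardy_pow_mul {α : ℝ} (n : ℕ) (f : ℝ → ℂ) {x : ℝ} (hx : 0 < x) :
    hardy α (fun t : ℝ => (t : ℂ) ^ n * f t) x = (x : ℂ) ^ n * hardy (α + n) f x := by
  rw [hardy, hardy, ← mul_assoc]
  congr 1
  · rw [← Complex.ofReal_pow, ← Complex.ofReal_mul, ← Real.rpow_natCast, ← Real.rpow_add hx]
    congr 2; ring
  · rw [intervalIntegral.integral_of_le hx.le, intervalIntegral.integral_of_le hx.le]
    refine setIntegral_congr_fun measurableSet_Ioc fun y hy => ?_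
    rw [← mul_assoc, ← Complex.ofReal_pow, ← Complex.ofReal_mul, ← Real.rpow_natCast,
      ← Real.rpow_add hy.1]

/-! ### Regularity and boundary values of the rescaled coefficients -/

section Regularity

variable {a : ℝ} {s : ℝ → ℂ} {v : ℕ → ℝ → ℂ} {p : ℝ≥0∞}

/-- The vanishing order `2k` makes the quotient bounded. This breaks the circularity of the
recursion, in which `h_{k+1}` depends on `w_{k+1}`. -/
theorem IsExpansion.memLp_mul (hv : IsExpansion a s v) (ha : 0 < a)
    (hs : ∀ b, 0 ≤ b → IntervalIntegrable s volume 0 b)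
    (hsp : MemLp s p (volume.restrict (Ioo 0 1))) (k : ℕ) :
    MemLp (fun x => s x * (v k x / (x : ℂ) ^ (2 * k))) p (volume.restrict (Ioo 0 1)) := by
  obtain ⟨C, hC0, hC⟩ := hv.exists_norm_le_pow ha hs k
  have hc : ContinuousOn (fun x : ℝ => v k x / (x : ℂ) ^ (2 * k)) (Ioo 0 1) := by
    refine ((hv.continuousOn k).mono (fun x hx => hx.1.le)).div
      (Continuous.continuousOn (by fun_prop)) fun x hx => ?_
    exact pow_ne_zero _ (by exact_mod_cast hx.1.ne')
  refine MemLp.of_le_mul (c := C) hsp (hsp.1.mul (hc.aestronglyMeasurable measurableSet_Ioo)) ?_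
  filter_upwards [ae_restrict_mem measurableSet_Ioo] with x hx
  have hx2 : 0 < x ^ (2 * k) := pow_pos hx.1 _
  have : ‖v k x / (x : ℂ) ^ (2 * k)‖ ≤ C := by
    rw [norm_div, norm_pow, Complex.norm_real, Real.norm_of_nonneg hx.1.le, div_le_iff₀ hx2]
    exact hC x (Ioo_subset_Icc_self hx)
  rw [norm_mul, mul_comm]
  gcongr

/-- Pulling powers of `t` out of the averages with `hardy_pow_mul` gives `h_{k+1} = x hardy_{a+2k+2}
(s w_{k+1}) - hardy_{a+2k+1} w_k`. The first term has boundary value `0`, the second contributes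
`-C_k / (a+2k+2)`, which equals `(2k+2) C_{k+1}`. -/
theorem IsExpansion.hasPrimitive (hv : IsExpansion a s v) (ha : 0 < a)
    (hs : ∀ b, 0 ≤ b → IntervalIntegrable s volume 0 b) (hp : 1 ≤ p)
    (hsp : MemLp s p (volume.restrict (Ioo 0 1))) {C : ℕ → ℂ} (hC0 : C 0 = 1)
    (hC : ∀ k, C (k + 1) = -C k / ((2 * k + 2) * (a + 2 * k + 2))) (k : ℕ) :
    HasPrimitive p (C k) (fun x => v k x / (x : ℂ) ^ (2 * k)) ∧
    HasPrimitive p (2 * k * C k)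
      (fun x => (x : ℂ) * hardy a (source s v k) x / (x : ℂ) ^ (2 * k)) := by
  induction k with
  | zero =>
    have h0 := hv.memLp_mul ha hs hsp 0
    simp only [mul_zero, pow_zero, div_one] at h0
    refine ⟨⟨hardy a (source s v 0), memLp_hardy ha zero_le_one hp h0, fun x hx => ?_⟩, ?_⟩
    · simpa [hC0, volt] using hv.eq 0 x hx.1.le
    · simpa using! hasPrimitive_mul_hardy ha hp h0
  | succ k ih =>
    have h1 := hv.memLp_mul ha hs hsp (k + 1)
    have hk : (0:ℝ) < a + (2 * (k + 1) : ℕ) := by positivity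
    have hk' : (0:ℝ) < a + (2 * k + 1 : ℕ) + 1 := by positivity
    have hH : HasPrimitive p (2 * (k + 1 : ℕ) * C (k + 1)) (fun x =>
        (x : ℂ) * hardy a (source s v (k + 1)) x / (x : ℂ) ^ (2 * (k + 1))) := by
      have h2 := hasPrimitive_mul_hardy hk hp h1
      have h3 := (ih.1.hardy hk' hp).const_mul (-1)
      have h4 := h2.add hp h3
      have e : 2 * ((k + 1 : ℕ) : ℂ) * C (k + 1) =
          0 + -1 * (C k / ((a + (2 * k + 1 : ℕ) + 1 : ℝ) : ℂ)) := by
        rw [hC]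
        have hn1 : (2 * k + 2 : ℂ) ≠ 0 := by
          have : ((2 * k + 2 : ℝ) : ℂ) ≠ 0 := by
            rw [Complex.ofReal_ne_zero]; positivity
          simpa using this
        have hn2 : (a + 2 * k + 2 : ℂ) ≠ 0 := by
          have : ((a + 2 * k + 2 : ℝ) : ℂ) ≠ 0 := by
            rw [Complex.ofReal_ne_zero]; positivity
          simpa using this
        push_cast
        rw [show (a + (2 * k + 1) + 1 : ℂ) = a + 2 * k + 2 by ring]
        field_simp
        ring
      rw [e]
      refine h4.congr fun x hx => ?_
      have hx0 : (x : ℂ) ≠ 0 := by exact_mod_cast hx.1.ne'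
      simp only
      rw [hardy_source_succ ha.le
        (intervalIntegrable_mul_of_continuousOn hs (hv.continuousOn (k + 1)) x hx.1.le)
        (intervalIntegrable_id_mul (hv.continuousOn k) x hx.1.le)]
      have e1 : hardy a (fun t => s t * v (k + 1) t) x = (x : ℂ) ^ (2 * (k + 1)) *
          hardy (a + (2 * (k + 1) : ℕ))
            (fun t => s t * (v (k + 1) t / (t : ℂ) ^ (2 * (k + 1)))) x := by
        rw [← hardy_pow_mul _ _ hx.1]
        refine hardy_congr hx.1.le fun t ht => ?_
        have ht0 : (t : ℂ) ≠ 0 := by exact_mod_cast ht.1.ne'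
        field_simp
      have e2 : hardy a (fun t : ℝ => (t : ℂ) * v k t) x = (x : ℂ) ^ (2 * k + 1) *
          hardy (a + (2 * k + 1 : ℕ)) (fun t => v k t / (t : ℂ) ^ (2 * k)) x := by
        rw [← hardy_pow_mul _ _ hx.1]
        refine hardy_congr hx.1.le fun t ht => ?_
        have ht0 : (t : ℂ) ≠ 0 := by exact_mod_cast ht.1.ne'
        rw [pow_succ]
        field_simp
      rw [e1, e2, add_sub_cancel_right]
      field_simp
      ring
    refine ⟨?_, hH⟩
    -- For positive index the constant term is absent, so `v_{k+1}` is the integral of `t^(2k+1)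
    -- h_{k+1}`, and `w_{k+1}` is a Hardy average of `h_{k+1}` with exponent `2k+1`.
    have h5 := hH.hardy (α := 2 * (k + 1 : ℕ)) (by positivity) hp
    have e : 2 * ((k + 1 : ℕ) : ℂ) * C (k + 1) / ((2 * (k + 1 : ℕ) : ℝ) : ℂ) = C (k + 1) := by
      have : ((k + 1 : ℕ) : ℂ) ≠ 0 := by exact_mod_cast (Nat.succ_ne_zero k)
      push_cast at this ⊢
      field_simp
    rw [e] at h5
    refine h5.congr fun x hx => ?_
    have hx0 : (x : ℂ) ≠ 0 := by exact_mod_cast hx.1.ne'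
    rw [hv.eq (k + 1) x hx.1.le]
    simp only [Nat.add_eq_zero_iff, one_ne_zero, and_false, if_false, zero_add]
    rw [volt, eq_div_iff (pow_ne_zero _ hx0), hardy, mul_comm, ← mul_assoc]
    have e3 : (x : ℂ) ^ (2 * (k + 1)) * ((x ^ (-(2 * ((k + 1 : ℕ) : ℝ) - 1) - 1) : ℝ) : ℂ) = 1 := by
      rw [← Complex.ofReal_pow, ← Complex.ofReal_mul, ← Real.rpow_natCast, ← Real.rpow_add hx.1]
      have : ((2 * (k + 1) : ℕ) : ℝ) + (-(2 * ((k + 1 : ℕ) : ℝ) - 1) - 1) = 0 := by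
        push_cast; ring
      rw [this]; simp
    rw [e3, one_mul, intervalIntegral.integral_of_le hx.1.le,
      intervalIntegral.integral_of_le hx.1.le]
    refine setIntegral_congr_fun measurableSet_Ioc fun t ht => ?_
    have ht0 : (t : ℂ) ≠ 0 := by exact_mod_cast ht.1.ne'
    have e4 : ((t ^ (2 * ((k + 1 : ℕ) : ℝ) - 1) : ℝ) : ℂ) = (t : ℂ) ^ (2 * k + 1) := by
      rw [← Complex.ofReal_pow, ← Real.rpow_natCast]
      congr 2; push_cast; ring
    simp only [e4]
    rw [show 2 * (k + 1) = 2 * k + 1 + 1 by ring, pow_succ (t : ℂ) (2 * k + 1)]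
    field_simp

end Regularity

/-- The coefficient `x (q(x) - z)` of the Volterra equation equivalent to the differential
equation. -/
noncomputable def coeff (q : ℝ → ℝ) (z : ℂ) (x : ℝ) : ℂ := (x : ℂ) * ((q x : ℂ) - z)

/-! ### Equivalence of the differential and the Volterra equation -/

section Equation

variable {l : ℝ} {q : ℝ → ℝ} {z : ℂ}

theorem ae_hasDerivAt_mul_hardy_Ioi {α : ℝ} (hα : 0 ≤ α) {f : ℝ → ℂ}
    (hf : ∀ b, 0 ≤ b → IntervalIntegrable f volume 0 b) :
    ∀ᵐ x ∂(volume.restrict (Ioi (0:ℝ))), HasDerivAt (fun x : ℝ => (x : ℂ) * hardy α f x)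
      (f x - α * hardy α f x) x := by
  rw [ae_restrict_iff' measurableSet_Ioi]
  have h := ae_all_iff.2 fun n : ℕ => ae_hasDerivAt_mul_hardy hα n.cast_nonneg (hf n n.cast_nonneg)
  filter_upwards [h] with x hx hx0
  obtain ⟨n, hn⟩ := exists_nat_gt x
  exact hx n ⟨hx0, hn⟩

theorem hasDerivAt_rpow_ofReal (m : ℝ) {x : ℝ} (hx : 0 < x) :
    HasDerivAt (fun y : ℝ => ((y ^ m : ℝ) : ℂ)) ((m * x ^ (m - 1) : ℝ) : ℂ) x :=
  (Real.hasDerivAt_rpow_const (Or.inl hx.ne')).ofReal_comp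

theorem hasDerivAt_of_volterra {a : ℝ} (ha : 0 < a) {f v : ℝ → ℂ} {c : ℂ}
    (hf : ∀ b, 0 ≤ b → IntervalIntegrable f volume 0 b)
    (hv : ∀ x, 0 ≤ x → v x = c + volt a f x) {x : ℝ} (hx : 0 < x) :
    HasDerivAt v (hardy a f x) x := by
  refine ((hasDerivAt_volt ha hf hx).const_add c).congr_of_eventuallyEq ?_
  filter_upwards [Ioi_mem_nhds hx] with y hy
  exact hv y (le_of_lt hy)

theorem hasDerivAt_rpow_mul {a : ℝ} (ha : 0 < a) {f v : ℝ → ℂ} {c : ℂ} (l : ℝ)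
    (hf : ∀ b, 0 ≤ b → IntervalIntegrable f volume 0 b)
    (hv : ∀ x, 0 ≤ x → v x = c + volt a f x) {x : ℝ} (hx : 0 < x) :
    HasDerivAt (fun x : ℝ => ((x ^ (l + 1) : ℝ) : ℂ) * v x)
      (((x ^ l : ℝ) : ℂ) * ((l + 1) * v x + x * hardy a f x)) x := by
  have h := (hasDerivAt_rpow_ofReal (l + 1) hx).mul (hasDerivAt_of_volterra ha hf hv hx)
  convert! h using 1
  rw [add_sub_cancel_right, Real.rpow_add hx, Real.rpow_one]
  push_cast
  ring

theorem isNormalizedSolution_of_volterra (hl : -1 / 2 < l)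
    (hr : ∀ b, 0 ≤ b → IntervalIntegrable (coeff q z) volume 0 b) {v : ℝ → ℂ}
    (hvc : ContinuousOn v (Ici 0))
    (hv : ∀ x, 0 ≤ x → v x = 1 + volt (2 * l + 1) (fun t => coeff q z t * v t) x) :
    IsNormalizedSolution l q z (fun x => ((x ^ (l + 1) : ℝ) : ℂ) * v x) := by
  have ha : 0 < 2 * l + 1 := by linarith
  set f := fun t => coeff q z t * v t with hfdef
  have hf : ∀ b, 0 ≤ b → IntervalIntegrable f volume 0 b :=
    intervalIntegrable_mul_of_continuousOn hr hvc
  have hu := fun {x : ℝ} (hx : 0 < x) => hasDerivAt_rpow_mul ha l hf hv hx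
  refine ⟨⟨fun x hx => (hu hx).differentiableAt, fun x y hx hxy => ?_, ?_⟩, ?_⟩
  · have hy : 0 < y := hx.trans_le hxy
    have hvac : AbsolutelyContinuousOnInterval v x y := by
      have h1 : AbsolutelyContinuousOnInterval (volt (2 * l + 1) f) x y :=
        (absolutelyContinuousOnInterval_integral (intervalIntegrable_hardy ha hy.le (hf y hy.le))
          left_mem_uIcc).mono (by
            rw [uIcc_of_le hxy, uIcc_of_le hy.le]; exact Icc_subset_Icc_left hx.le)
      refine ((absolutelyContinuousOnInterval_const 1 x y).fun_add h1).congr_eqOn fun t ht => ?_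
      rw [uIcc_of_le hxy] at ht
      exact (hv t (hx.le.trans ht.1)).symm
    have h2 := (absolutelyContinuousOnInterval_rpow l hx hy).complex_mul
      ((hvac.const_smul (l + 1 : ℂ)).fun_add
        (absolutelyContinuousOnInterval_mul_hardy ha.le hx hxy (hf y hy.le)))
    refine h2.congr_eqOn fun t ht => ?_
    rw [uIcc_of_le hxy] at ht
    exact (hu (hx.trans_le ht.1)).deriv.symm
  · filter_upwards [ae_hasDerivAt_mul_hardy_Ioi ha.le hf, ae_restrict_mem measurableSet_Ioi]
      with x hx hx0
    have hx0 : 0 < x := hx0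
    have h1 := (hasDerivAt_rpow_ofReal l hx0).mul
      (((hasDerivAt_of_volterra ha hf hv hx0).const_mul (l + 1 : ℂ)).add hx)
    have h2 := h1.congr_of_eventuallyEq
      (f₁ := deriv fun x : ℝ => ((x ^ (l + 1) : ℝ) : ℂ) * v x) (by
      filter_upwards [Ioi_mem_nhds hx0] with y hy
      exact (hu hy).deriv)
    refine ⟨_, h2, ?_⟩
    have e1 : ((x ^ (l - 1) : ℝ) : ℂ) * x = ((x ^ l : ℝ) : ℂ) := by
      rw [← Complex.ofReal_mul, Real.rpow_sub_one hx0.ne', div_mul_cancel₀ _ hx0.ne']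
    have e2 : ((x ^ (l + 1) : ℝ) : ℂ) = ((x ^ l : ℝ) : ℂ) * x := by
      rw [← Complex.ofReal_mul, Real.rpow_add_one hx0.ne']
    have hxc : (x : ℂ) ≠ 0 := by exact_mod_cast hx0.ne'
    simp only [hfdef, coeff, e2, ← e1, Pi.add_apply]
    push_cast
    field_simp
    ring
  · have h1 : Tendsto v (𝓝[>] 0) (𝓝 1) := by
      have h2 := hvc 0 self_mem_Ici
      have h0 : v 0 = 1 := by rw [hv 0 le_rfl]; simp [volt]
      rw [ContinuousWithinAt, h0] at h2
      exact h2.mono_left (nhdsWithin_mono _ Ioi_subset_Ici_self)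
    refine h1.congr' ?_
    filter_upwards [self_mem_nhdsWithin] with x hx
    have : ((x ^ (l + 1) : ℝ) : ℂ) ≠ 0 := by
      exact_mod_cast (Real.rpow_pos_of_pos hx _).ne'
    rw [mul_div_cancel_left₀ _ this]

/-- Every normalized solution comes from a solution of the Volterra equation. -/
theorem IsNormalizedSolution.exists_volterra (hl : -1 / 2 < l)
    (hr : ∀ b, 0 ≤ b → IntervalIntegrable (coeff q z) volume 0 b) {u : ℝ → ℂ}
    (hu : IsNormalizedSolution l q z u) :
    ∃ v : ℝ → ℂ, ContinuousOn v (Ici 0) ∧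
      (∀ x, 0 ≤ x → v x = 1 + volt (2 * l + 1) (fun t => coeff q z t * v t) x) ∧
      ∀ x > 0, u x = ((x ^ (l + 1) : ℝ) : ℂ) * v x := by
  obtain ⟨⟨hud, huac, hode⟩, hlim⟩ := hu
  have ha : 0 < 2 * l + 1 := by linarith
  set a := 2 * l + 1 with hadef
  have hpow : ∀ x : ℝ, 0 < x → ∀ m : ℝ, ((x ^ m : ℝ) : ℂ) ≠ 0 := fun x hx m => by
    exact_mod_cast (Real.rpow_pos_of_pos hx m).ne'
  -- The value `1` at `0` is the limit given by the normalization, so `v` is continuous on `[0, ∞)`.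
  let v : ℝ → ℂ := fun x => if x ≤ 0 then 1 else u x / ((x ^ (l + 1) : ℝ) : ℂ)
  have hvx : ∀ x, 0 < x → v x = u x / ((x ^ (l + 1) : ℝ) : ℂ) := fun x hx => if_neg (not_le.2 hx)
  have hv0 : v 0 = 1 := if_pos le_rfl
  have hvd : ∀ x, 0 < x → HasDerivAt v (((x ^ (-a - 1) : ℝ) : ℂ) *
      (((x ^ (l + 1) : ℝ) : ℂ) * deriv u x - (l + 1) * ((x ^ l : ℝ) : ℂ) * u x)) x := by
    intro x hx
    have h1 := (hud x hx).hasDerivAt.div (hasDerivAt_rpow_ofReal (l + 1) hx) (hpow x hx _)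
    have h2 := h1.congr_of_eventuallyEq (f₁ := v) (by
      filter_upwards [Ioi_mem_nhds hx] with y hy
      exact hvx y hy)
    convert! h2 using 1
    have e1 : ((x ^ (-a - 1) : ℝ) : ℂ) = (((x ^ (l + 1) : ℝ) : ℂ) ^ 2)⁻¹ := by
      rw [← Complex.ofReal_pow, ← Complex.ofReal_inv, ← Real.rpow_natCast, ← Real.rpow_mul hx.le,
        ← Real.rpow_neg hx.le]
      congr 2; push_cast; rw [hadef]; ring
    rw [e1, add_sub_cancel_right]
    push_cast
    field_simp
  have hvt : Tendsto v (𝓝[>] 0) (𝓝 1) := by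
    refine hlim.congr' ?_
    filter_upwards [self_mem_nhdsWithin] with x hx
    exact (hvx x hx).symm
  have hvc : ContinuousOn v (Ici 0) := by
    intro x hx
    rcases (show (0:ℝ) ≤ x from hx).eq_or_lt with h | h
    · subst h
      rw [← Ioi_insert, continuousWithinAt_insert_self, ContinuousWithinAt, hv0]
      exact hvt
    · exact (hvd x h).continuousAt.continuousWithinAt
  set f := fun t => coeff q z t * v t with hfdef
  have hf : ∀ b, 0 ≤ b → IntervalIntegrable f volume 0 b :=
    intervalIntegrable_mul_of_continuousOn hr hvc
  -- This is `x^(a+1) v'`, the Wronskian of `x^(l+1)` and `u`. The singular potential cancels in its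
  -- derivative, so `P` and `N` have the same derivative almost everywhere.
  let P : ℝ → ℂ := fun x =>
    ((x ^ (l + 1) : ℝ) : ℂ) * deriv u x - (l + 1) * ((x ^ l : ℝ) : ℂ) * u x
  let N : ℝ → ℂ := fun x => ∫ y in 0..x, ((y ^ a : ℝ) : ℂ) * f y
  have hNi : ∀ b, 0 ≤ b → IntervalIntegrable (fun y : ℝ => ((y ^ a : ℝ) : ℂ) * f y) volume 0 b :=
    fun b hb => intervalIntegrable_rpow_mul ha.le (hf b hb)
  have hP' : ∀ᵐ x ∂(volume.restrict (Ioi (0:ℝ))), HasDerivAt P (((x ^ a : ℝ) : ℂ) * f x) x := by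
    filter_upwards [hode, ae_restrict_mem measurableSet_Ioi] with x hx hx0
    obtain ⟨u'', h1, h2⟩ := hx
    have hx0 : 0 < x := hx0
    have hxc : (x : ℂ) ≠ 0 := by exact_mod_cast hx0.ne'
    have h3 := ((hasDerivAt_rpow_ofReal (l + 1) hx0).mul h1).sub
      (((hasDerivAt_rpow_ofReal l hx0).const_mul (l + 1 : ℂ)).mul (hud x hx0).hasDerivAt)
    convert! h3 using 1
    have e1 : ((x ^ (l - 1) : ℝ) : ℂ) * x = ((x ^ l : ℝ) : ℂ) := by
      rw [← Complex.ofReal_mul, Real.rpow_sub_one hx0.ne', div_mul_cancel₀ _ hx0.ne']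
    have e2 : ((x ^ (l + 1) : ℝ) : ℂ) = ((x ^ l : ℝ) : ℂ) * x := by
      rw [← Complex.ofReal_mul, Real.rpow_add_one hx0.ne']
    have e3 : ((x ^ a : ℝ) : ℂ) = ((x ^ l : ℝ) : ℂ) * ((x ^ l : ℝ) : ℂ) * x := by
      rw [← Complex.ofReal_mul, ← Complex.ofReal_mul, ← Real.rpow_add hx0,
        ← Real.rpow_add_one hx0.ne']
      congr 2; rw [hadef]; ring
    have h4 : u'' = ((l * (l + 1) / x ^ 2 + q x : ℝ) : ℂ) * u x - z * u x := by
      linear_combination -h2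
    have hl0 := hpow x hx0 (l - 1)
    simp only [hfdef, coeff, hvx x hx0, h4, e3, e2, ← e1, add_sub_cancel_right]
    push_cast
    simp only [← e1]
    field_simp
    ring
  have hPN : ∀ x, 0 < x → ∀ y, x ≤ y → P y - N y = P x - N x := by
    intro x hx y hxy
    rcases hxy.eq_or_lt with rfl | hlt
    · rfl
    have hy : 0 < y := hx.trans_le hxy
    have hixy : IntervalIntegrable (fun y : ℝ => ((y ^ a : ℝ) : ℂ) * f y) volume x y :=
      (hNi x hx.le).symm.trans (hNi y hy.le)
    -- The definition of a solution gives absolute continuity of `u'` only; `u` inherits it by being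
    -- continuously differentiable.
    have huac' : AbsolutelyContinuousOnInterval u x y := by
      refine ContDiffOn.absolutelyContinuousOnInterval ?_
      rw [uIcc_of_le hxy]
      have hd : ContinuousOn (deriv u) (Icc x y) := by
        have := (huac x y hx hxy).continuousOn
        rwa [uIcc_of_le hxy] at this
      refine (contDiffOn_succ_iff_derivWithin (n := 0) (uniqueDiffOn_Icc hlt)).2
        ⟨fun t ht => (hud t (hx.trans_le ht.1)).differentiableWithinAt, by simp, ?_⟩
      rw [contDiffOn_zero]
      refine hd.congr fun t ht => ?_
      exact (hud t (hx.trans_le ht.1)).derivWithin (uniqueDiffOn_Icc hlt t ht)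
    have hPac : AbsolutelyContinuousOnInterval P x y :=
      ((absolutelyContinuousOnInterval_rpow (l + 1) hx hy).complex_mul
        (huac x y hx hxy)).fun_sub
      (((absolutelyContinuousOnInterval_rpow l hx hy).const_smul (l + 1 : ℂ)).complex_mul huac')
    have h1 := integral_eq_sub_of_ae_hasDerivAt hPac hixy (by
      rw [ae_restrict_iff' measurableSet_Ioi] at hP'
      filter_upwards [hP'] with t ht hm
      rw [uIcc_of_le hxy] at hm
      exact ht (hx.trans_le hm.1))
    have h2 := intervalIntegral.integral_add_adjacent_intervals (hNi x hx.le) hixy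
    simp only [N]
    rw [← h2, h1]
    ring
  have hPc : ∀ x, 0 < x → P x = (P 1 - N 1) + N x := by
    intro x hx
    rcases le_total x 1 with h | h
    · rw [hPN x hx 1 h]; ring
    · rw [← hPN 1 one_pos x h]; ring
  set c := P 1 - N 1
  have hvd' : ∀ x, 0 < x →
      HasDerivAt v (c * ((x ^ (-a - 1) : ℝ) : ℂ) + hardy a f x) x := by
    intro x hx
    convert! hvd x hx using 1
    have := hPc x hx
    simp only [P] at this
    rw [this, hardy]
    ring
  obtain ⟨K, hK⟩ : ∃ K, ∀ x ∈ Ioi (0:ℝ),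
      v x - volt a f x + c / a * ((x ^ (-a) : ℝ) : ℂ) = K := by
    have hac : (a : ℂ) ≠ 0 := by exact_mod_cast ha.ne'
    have h1 : ∀ x ∈ Ioi (0:ℝ), HasDerivAt
        (fun x => v x - volt a f x + c / a * ((x ^ (-a) : ℝ) : ℂ)) 0 x := by
      intro x hx
      have h2 := ((hvd' x hx).sub (hasDerivAt_volt ha hf hx)).add
        ((hasDerivAt_rpow_ofReal (-a) hx).const_mul (c / a))
      convert! h2 using 1
      push_cast
      field_simp
      ring
    exact isOpen_Ioi.exists_is_const_of_deriv_eq_zero isPreconnected_Ioi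
      (fun x hx => (h1 x hx).differentiableAt.differentiableWithinAt) (fun x hx => (h1 x hx).deriv)
  have hvolt : Tendsto (volt a f) (𝓝[>] 0) (𝓝 0) := by
    have h2 := volt_continuousOn ha hf 0 self_mem_Ici
    rw [ContinuousWithinAt, show volt a f 0 = 0 by simp [volt]] at h2
    exact h2.mono_left (nhdsWithin_mono _ Ioi_subset_Ici_self)
  have hxa : Tendsto (fun x : ℝ => ((x ^ a : ℝ) : ℂ)) (𝓝[>] 0) (𝓝 0) := by
    have h1 : Continuous fun x : ℝ => ((x ^ a : ℝ) : ℂ) :=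
      Complex.continuous_ofReal.comp (Real.continuous_rpow_const ha.le)
    have h2 := h1.tendsto 0
    rw [Real.zero_rpow ha.ne', Complex.ofReal_zero] at h2
    exact h2.mono_left nhdsWithin_le_nhds
  -- The term `c/a * x^(-a)` comes from the second solution. Multiplying the identity for `K` by
  -- `x^a` and letting `x → 0` isolates `c/a`, while the other terms stay bounded and vanish in the
  -- limit.
  have hc : c = 0 := by
    have hac : (a : ℂ) ≠ 0 := by exact_mod_cast ha.ne'
    have h1 : Tendsto (fun x : ℝ => ((x ^ a : ℝ) : ℂ) * (K - (v x - volt a f x))) (𝓝[>] 0)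
        (𝓝 (0 * (K - (1 - 0)))) := hxa.mul (tendsto_const_nhds.sub (hvt.sub hvolt))
    have h2 : Tendsto (fun x : ℝ => ((x ^ a : ℝ) : ℂ) * (K - (v x - volt a f x))) (𝓝[>] 0)
        (𝓝 (c / a)) := by
      refine tendsto_const_nhds.congr' ?_
      filter_upwards [self_mem_nhdsWithin] with x hx
      have h3 : ((x ^ a : ℝ) : ℂ) * ((x ^ (-a) : ℝ) : ℂ) = 1 := by
        rw [← Complex.ofReal_mul, ← Real.rpow_add hx]; simp
      rw [← hK x hx]
      linear_combination -(c / a) * h3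
    have h4 := tendsto_nhds_unique h1 h2
    rw [zero_mul] at h4
    exact (div_eq_zero_iff.1 h4.symm).resolve_right hac
  have hK1 : K = 1 := by
    have h1 : Tendsto (fun x => v x - volt a f x) (𝓝[>] 0) (𝓝 (1 - 0)) := hvt.sub hvolt
    have h2 : Tendsto (fun x => v x - volt a f x) (𝓝[>] 0) (𝓝 K) := by
      refine tendsto_const_nhds.congr' ?_
      filter_upwards [self_mem_nhdsWithin] with x hx
      rw [← hK x hx, hc]; ring
    rw [tendsto_nhds_unique h2 h1, sub_zero]
  refine ⟨v, hvc, fun x hx => ?_, fun x hx => ?_⟩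
  · rcases hx.eq_or_lt with h | h
    · subst h; simp [hv0, volt]
    · have := hK x h
      rw [hc, hK1] at this
      linear_combination this
  · rw [hvx x hx, mul_div_cancel₀ _ (hpow x hx _)]

end Equation

theorem one_le_of_mem_exponents {l : ℝ} {p : ℝ≥0∞} (hp : p ∈ exponents l) : 1 ≤ p := by
  unfold exponents at hp
  split_ifs at hp
  · exact hp.1
  · exact hp.1

/-! ### Integrability of the Volterra coefficient -/

section Coefficient

variable {q : ℝ → ℝ} {p : ℝ≥0∞}

theorem memLp_coeff (hqp : MemLp (fun x : ℝ => x * q x) p (volume.restrict (Ioo 0 1))) (z : ℂ) :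
    MemLp (coeff q z) p (volume.restrict (Ioo 0 1)) := by
  have h1 : MemLp (fun x : ℝ => (x : ℂ) * -z) p (volume.restrict (Ioo 0 1)) := by
    refine MemLp.of_bound (Continuous.aestronglyMeasurable (by fun_prop)) ‖z‖ ?_
    filter_upwards [ae_restrict_mem measurableSet_Ioo] with x hx
    rw [norm_mul, norm_neg, Complex.norm_real, Real.norm_of_nonneg hx.1.le]
    exact mul_le_of_le_one_left (norm_nonneg _) hx.2.le
  have h2 : MemLp (fun x : ℝ => ((x * q x : ℝ) : ℂ)) p (volume.restrict (Ioo 0 1)) := hqp.ofReal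
  refine (memLp_congr_ae (ae_of_all _ fun x => ?_)).1 (h2.add h1)
  simp only [coeff, Pi.add_apply]
  push_cast
  ring

theorem intervalIntegrable_coeff (hq : LocallyIntegrableOn q (Ioi 0) volume) (hp : 1 ≤ p)
    (hqp : MemLp (fun x : ℝ => x * q x) p (volume.restrict (Ioo 0 1))) (z : ℂ) :
    ∀ b, 0 ≤ b → IntervalIntegrable (coeff q z) volume 0 b := by
  have h1 := intervalIntegrable_of_memLp hp (memLp_coeff hqp z) (right_mem_Icc.2 zero_le_one)
  intro b hb
  rcases le_total b 1 with h | h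
  · exact intervalIntegrable_of_memLp hp (memLp_coeff hqp z) ⟨hb, h⟩
  · refine h1.trans ?_
    have h2 : IntegrableOn q (Icc 1 b) volume :=
      hq.integrableOn_compact_subset (fun x hx => one_pos.trans_le hx.1) isCompact_Icc
    have h3 : IntervalIntegrable q volume 1 b := by
      rw [intervalIntegrable_iff_integrableOn_Icc_of_le h]; exact h2
    have h4 : IntervalIntegrable (fun x => (q x : ℂ)) volume 1 b := ⟨h3.1.ofReal, h3.2.ofReal⟩
    exact (h4.sub intervalIntegrable_const).continuousOn_mul
      Complex.continuous_ofReal.continuousOn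

end Coefficient

theorem IsExpansion.differentiable_tsum {a : ℝ} {s : ℝ → ℂ} {v : ℕ → ℝ → ℂ}
    (hv : IsExpansion a s v) (ha : 0 < a)
    (hs : ∀ b, 0 ≤ b → IntervalIntegrable s volume 0 b) {x : ℝ} (hx : 0 ≤ x) :
    Differentiable ℂ fun ζ : ℂ => ∑' k, ζ ^ k * v k x := by
  intro ζ
  -- The bound at the real point `‖ζ‖ + 1` dominates every term on the ball of that radius, so the
  -- series of polynomials in `ζ` converges uniformly there.
  obtain ⟨B, hB, h⟩ := hv.exists_bound ha hs (‖ζ‖ + 1 : ℝ) hx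
  have h1 : DifferentiableOn ℂ (fun ζ : ℂ => ∑' k, ζ ^ k * v k x) (Metric.ball 0 (‖ζ‖ + 1)) := by
    refine Complex.differentiableOn_tsum_of_summable_norm hB
      (fun k => Differentiable.differentiableOn (by fun_prop)) Metric.isOpen_ball fun k w hw => ?_
    refine le_trans ?_ (h k x ⟨hx, le_rfl⟩)
    rw [mem_ball_zero_iff] at hw
    rw [norm_mul, norm_mul, norm_pow, norm_pow, Complex.norm_real,
      Real.norm_of_nonneg (by positivity)]
    gcongr
  exact h1.differentiableAt (Metric.isOpen_ball.mem_nhds (by simp))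

/-- The denominator matches the Pochhammer recursion because `(2l+1) + 2k + 2 = 2 (l + 3/2 + k)`.
The division by `k!` adjusts `coeffC` to the unnormalized coefficients `w_k`. -/
theorem coeffC_succ {l : ℝ} (hl : -1 / 2 < l) (k : ℕ) :
    ((coeffC l (k + 1) / (k + 1).factorial : ℝ) : ℂ) = -((coeffC l k / k.factorial : ℝ) : ℂ) /
      ((2 * k + 2) * ((2 * l + 1 : ℝ) + 2 * k + 2)) := by
  have h1 : (0:ℝ) < l + 3 / 2 + k := by
    have : (0:ℝ) ≤ k := k.cast_nonneg
    linarith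
  have h2 : (0:ℝ) < (ascPochhammer ℝ k).eval (l + 3 / 2) := ascPochhammer_pos k _ (by linarith)
  have h3 : (0:ℝ) < 2 * l + 1 + 2 * k + 2 := by linarith
  have h4 : coeffC l (k + 1) / (k + 1).factorial = -(coeffC l k / k.factorial) /
      ((2 * k + 2) * ((2 * l + 1) + 2 * k + 2)) := by
    have h5 : (k.factorial : ℝ) ≠ 0 := by positivity
    have h6 : (k : ℝ) + 1 ≠ 0 := by positivity
    rw [coeffC, coeffC, ascPochhammer_succ_eval, Nat.factorial_succ,
      show 2 * l + 1 + 2 * (k : ℝ) + 2 = 2 * (l + 3 / 2 + k) by ring]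
    push_cast
    rw [show (2 * k + 2 : ℝ) = 2 * (k + 1) by ring]
    field_simp
    ring
  rw [h4]
  push_cast
  ring

end PerturbedBessel

/-! ### Assembly of the main theorem -/

open PerturbedBessel

theorem lemma3p5 (l : ℝ) (hl : -1 / 2 < l) (q : ℝ → ℝ)
    (hq : LocallyIntegrableOn q (Ioi 0) volume)
    (p : ℝ≥0∞) (hp : p ∈ PerturbedBessel.exponents l)
    (hqp : MemLp (fun x : ℝ => x * q x) p (volume.restrict (Ioo 0 1))) :
    ∃ φ : ℂ → ℝ → ℂ,
      (∀ z : ℂ, PerturbedBessel.IsNormalizedSolution l q z (φ z)) ∧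
      (∀ (z : ℂ) (u : ℝ → ℂ), PerturbedBessel.IsNormalizedSolution l q z u →
        ∀ x > 0, u x = φ z x) ∧
      (∀ x > 0, Differentiable ℂ (fun z : ℂ => φ z x)) ∧
      ∀ z₀ : ℂ, ∃ φt φh : ℕ → ℝ → ℂ,
        (∀ (z : ℂ) (x : ℝ), 0 < x →
          Summable (fun k : ℕ =>
            (x : ℂ) ^ (2 * k) * φt k x / (k.factorial : ℂ) * (z - z₀) ^ k) ∧
          φ z x = ((x ^ (l + 1) : ℝ) : ℂ) * ∑' k : ℕ,
            (x : ℂ) ^ (2 * k) * φt k x / (k.factorial : ℂ) * (z - z₀) ^ k) ∧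
        (∀ (z : ℂ) (x : ℝ), 0 < x →
          Summable (fun k : ℕ =>
            (x : ℂ) ^ (2 * k) * φh k x / (k.factorial : ℂ) * (z - z₀) ^ k) ∧
          deriv (φ z) x = ((x ^ l : ℝ) : ℂ) * ∑' k : ℕ,
            (x : ℂ) ^ (2 * k) * φh k x / (k.factorial : ℂ) * (z - z₀) ^ k) ∧
        ∀ k : ℕ,
          PerturbedBessel.MemW1p p (φt k) ∧
          PerturbedBessel.MemW1p p (φh k) ∧
          φt k 0 = (PerturbedBessel.coeffC l k : ℂ) ∧
          φh k 0 = ((l + 1 + 2 * (k : ℝ)) * PerturbedBessel.coeffC l k : ℝ) ∧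
          (∀ x > 0, DifferentiableAt ℝ (φt k) x) ∧
          Tendsto (fun x : ℝ => (x : ℂ) * deriv (φt k) x) (𝓝[>] 0) (𝓝 0) := by
  have hp1 : 1 ≤ p := one_le_of_mem_exponents hp
  have ha : 0 < 2 * l + 1 := by linarith
  set a := 2 * l + 1 with hadef
  have hr := intervalIntegrable_coeff hq hp1 hqp
  choose V hVc hV using fun z => exists_volterra ha (hr z) (fun _ => 1) continuousOn_const
  -- With `ζ = z - z₀`, the factor `s - ζ t` is exactly `coeff q z`, so the sum of the series and `V
  -- z` solve the same Volterra equation.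
  have hVeq : ∀ z₀ v, IsExpansion a (coeff q z₀) v → ∀ z x, 0 ≤ x →
      V z x = ∑' k, (z - z₀) ^ k * v k x := by
    intro z₀ v hv z x hx
    refine eqOn_of_volterra ha hx (hr z x hx) ((hVc z).mono Icc_subset_Ici_self)
      ((hv.continuousOn_tsum ha (hr z₀) (z - z₀)).mono Icc_subset_Ici_self)
      (fun y hy => hV z y hy.1) (fun y hy => ?_) ⟨hx, le_rfl⟩
    rw [hv.tsum_eq ha (hr z₀) (z - z₀) hy.1]
    congr 2; ext t; simp only [coeff]; ring
  have hVi : ∀ z b, 0 ≤ b → IntervalIntegrable (fun t => coeff q z t * V z t) volume 0 b :=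
    fun z => intervalIntegrable_mul_of_continuousOn (hr z) (hVc z)
  refine ⟨fun z x => ((x ^ (l + 1) : ℝ) : ℂ) * V z x,
    fun z => isNormalizedSolution_of_volterra hl (hr z) (hVc z) (hV z),
    fun z u hu x hx => ?_, fun x hx => ?_, fun z₀ => ?_⟩
  · obtain ⟨v, hvc, hv, huv⟩ := hu.exists_volterra hl (hr z)
    rw [huv x hx]
    congr 1
    exact eqOn_of_volterra (f := fun _ => 1) ha hx.le (hr z x hx.le)
      (hvc.mono Icc_subset_Ici_self) ((hVc z).mono Icc_subset_Ici_self)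
      (fun y hy => hv y hy.1) (fun y hy => hV z y hy.1) ⟨hx.le, le_rfl⟩
  · obtain ⟨v, hv⟩ := exists_isExpansion ha (hr 0)
    simp only [fun z => hVeq 0 v hv z x hx.le, sub_zero]
    exact (hv.differentiable_tsum ha (hr 0) hx.le).const_mul _
  obtain ⟨v, hv⟩ := exists_isExpansion ha (hr z₀)
  have hF : ∀ k : ℕ, (k.factorial : ℂ) ≠ 0 := fun k => by exact_mod_cast k.factorial_ne_zero
  have hx0 : ∀ x : ℝ, 0 < x → (x : ℂ) ≠ 0 := fun x hx => by exact_mod_cast hx.ne'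
  let w : ℕ → ℝ → ℂ := fun k x => v k x / (x : ℂ) ^ (2 * k)
  let h : ℕ → ℝ → ℂ := fun k x => (x : ℂ) * hardy a (source (coeff q z₀) v k) x / (x : ℂ) ^ (2 * k)
  -- The quotients defining `w` and `h` carry no information at `0`, where the boundary value is
  -- prescribed instead.
  let φt : ℕ → ℝ → ℂ := fun k x => if x = 0 then (coeffC l k : ℂ) else k.factorial * w k x
  let φh : ℕ → ℝ → ℂ := fun k x => if x = 0 then ((l + 1 + 2 * (k : ℝ)) * coeffC l k : ℝ) else
    k.factorial * ((l + 1) * w k x + h k x)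
  have hφt : ∀ k x, 0 < x → φt k x = k.factorial * w k x := fun k x hx => if_neg hx.ne'
  have hφh : ∀ k x, 0 < x → φh k x = k.factorial * ((l + 1) * w k x + h k x) :=
    fun k x hx => if_neg hx.ne'
  have hφt0 : ∀ k, φt k 0 = coeffC l k := fun k => if_pos rfl
  have hφh0 : ∀ k, φh k 0 = ((l + 1 + 2 * (k : ℝ)) * coeffC l k : ℝ) := fun k => if_pos rfl
  refine ⟨φt, φh, fun z x hx => ?_, fun z x hx => ?_, fun k => ?_⟩
  · have e : (fun k : ℕ => (x : ℂ) ^ (2 * k) * φt k x / (k.factorial : ℂ) * (z - z₀) ^ k) =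
        fun k => (z - z₀) ^ k * v k x := by
      ext k
      have h1 := hF k
      have h2 := hx0 x hx
      rw [hφt k x hx]
      simp only [w]
      field_simp
    rw [e]
    exact ⟨(hv.hasSum ha (hr z₀) (z - z₀) hx.le).summable,
      congrArg (((x ^ (l + 1) : ℝ) : ℂ) * ·) (hVeq z₀ v hv z x hx.le)⟩
  · have e : (fun k : ℕ => (x : ℂ) ^ (2 * k) * φh k x / (k.factorial : ℂ) * (z - z₀) ^ k) =
        fun k => (l + 1) * ((z - z₀) ^ k * v k x) +
          x * ((z - z₀) ^ k * hardy a (source (coeff q z₀) v k) x) := by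
      ext k
      have h1 := hF k
      have h2 := hx0 x hx
      rw [hφh k x hx]
      simp only [w, h]
      field_simp
    have h1 := ((hv.hasSum ha (hr z₀) (z - z₀) hx.le).mul_left (l + 1 : ℂ)).add
      ((hv.hasSum_hardy_source ha (hr z₀) (z - z₀) hx.le).mul_left (x : ℂ))
    rw [e]
    refine ⟨h1.summable, ?_⟩
    rw [h1.tsum_eq, (hasDerivAt_rpow_mul ha l (hVi z) (hV z) hx).deriv, hVeq z₀ v hv z x hx.le]
    congr 3
    refine hardy_congr hx.le fun t ht => ?_
    rw [hVeq z₀ v hv z t ht.1.le]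
    simp only [coeff]
    ring
  · obtain ⟨hw, hh⟩ := hv.hasPrimitive ha (hr z₀) hp1 (memLp_coeff hqp z₀)
      (C := fun k => ((coeffC l k / k.factorial : ℝ) : ℂ)) (by simp [coeffC]) (coeffC_succ hl) k
    have hFk := hF k
    have ew : (k.factorial : ℂ) * ((coeffC l k / k.factorial : ℝ) : ℂ) = coeffC l k := by
      push_cast; field_simp
    have hd : ∀ x, 0 < x → HasDerivAt (φt k) (k.factorial * ((h k x - 2 * k * w k x) / x)) x := by
      intro x hx
      have hxc := hx0 x hx
      have hpow : HasDerivAt (fun x : ℝ => (x : ℂ) ^ (2 * k))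
          ((2 * k : ℕ) * (x : ℂ) ^ (2 * k - 1)) x := by
        simpa using! (Complex.ofRealCLM.hasDerivAt (x := x)).pow (2 * k)
      have hv1 := hasDerivAt_of_volterra ha (hv.intervalIntegrable_source (hr z₀) k) (hv.eq k) hx
      have h2 := ((hv1.div hpow (pow_ne_zero _ hxc)).const_mul (k.factorial : ℂ))
      have h3 := h2.congr_of_eventuallyEq (f₁ := φt k) (by
        filter_upwards [Ioi_mem_nhds hx] with y hy
        exact hφt k y hy)
      convert! h3 using 2
      simp only [w, h]
      -- For `k = 0` the exponent `2 * k - 1` truncates to `0`, so the factorization of `x^(2k)`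
      -- used for positive `k` fails.
      rcases Nat.eq_zero_or_pos k with hk | hk
      · subst hk; field_simp; simp
      · have : (x : ℂ) ^ (2 * k) = x * (x : ℂ) ^ (2 * k - 1) := by
          rw [← pow_succ']; congr 1; omega
        rw [this]
        have hq0 := pow_ne_zero (2 * k - 1) hxc
        push_cast
        field_simp
    refine ⟨?_, ?_, hφt0 k, hφh0 k, fun x hx => (hd x hx).differentiableAt, ?_⟩
    · refine HasPrimitive.memW1p hp1 ?_
      rw [hφt0, ← ew]
      exact (hw.const_mul k.factorial).congr fun x hx => (hφt k x hx.1).symm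
    · refine HasPrimitive.memW1p hp1 ?_
      rw [hφh0]
      have h1 := ((hw.const_mul (l + 1)).add hp1 hh).const_mul k.factorial
      have e : (((l + 1 + 2 * (k : ℝ)) * coeffC l k : ℝ) : ℂ) =
          k.factorial * ((l + 1) * ((coeffC l k / k.factorial : ℝ) : ℂ) +
            2 * k * ((coeffC l k / k.factorial : ℝ) : ℂ)) := by
        push_cast
        field_simp
      rw [e]
      exact h1.congr fun x hx => (hφh k x hx.1).symm
    -- Here `x φ̃_k' = k! (h_k - 2k w_k)`, and both terms tend to `2k` times the boundary value of
    -- `w_k`.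
    · have h1 := ((hh.tendsto hp1).sub ((hw.tendsto hp1).const_mul (2 * k : ℂ))).const_mul
        (k.factorial : ℂ)
      rw [sub_self, mul_zero] at h1
      refine h1.congr' ?_
      filter_upwards [self_mem_nhdsWithin] with x hx
      have hxc := hx0 x hx
      rw [(hd x hx).deriv]
      simp only [w, h]
      field_simp
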